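/- Setting. Fix $\bar c>0$. A decision maker has a largest outcome $\bar b>0$, a Lipschitz bound $L\ge 0$, a true utility function $u^*\in\mathcal U_c$, where $\mathcal U_c$ is the set of functions $u$ on $[0,\bar b]$ that are increasing, concave and $L$-Lipschitz with $u(0)=0$, $u(\bar b)=1$, and a true scale $\sigma^*\ge 1/\bar c$. There are $K\ge1$ queries $(W_k,Y_k)$, each a pair of lotteries with finitely many outcomes in $[0,\bar b]$. In query $k$ the decision maker chooses $W_k$ (recorded as $Z_k=1$) if $\mathbb E[u^*(W_k)]+\varepsilon_{k,1}\ge \mathbb E[u^*(Y_k)]+\varepsilon_{k,2}$, and $Y_k$ otherwise ($Z_k=-1$), where all the errors $\varepsilon_{k,i}$ are i.i.d. $\mathrm{Gumbel}(0,\sigma^*)$, i.e. have density $\frac1{\sigma^*}e^{-x/\sigma^*}e^{-e^{-x/\sigma^*}}$. Let $0=y_1<\dots<y_N=\bar b$ be the elements of the union of $\{0,\bar b\}$ and the supports of all the lotteries, let $P\in\mathbb R^{K\times(N-1)}$ have the entries $\mathbb P[W_k=y_j]-\mathbb P[Y_k=y_j]$ ($1\le k\le K$, $2\le j\le N$), and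 put $\Sigma_D=\frac1K P^\top P$. A maximum likelihood estimate (MLE) $(\hat u,\hat\sigma)$ is any maximizer of $$\ell(u,\sigma)=\sum_{k=1}^K\log\frac{1}{1+\exp\bigl(-Z_k(\mathbb E[u(W_k)]-\mathbb E[u(Y_k)])/\sigma\bigr)}$$ over $u\in\mathcal U_c$ and $\sigma\in[1/\bar c,\infty]$, with $1/\infty=0$. Put $\hat\alpha_j=\hat u(y_j)$, $\alpha^*_j=u^*(y_j)$ for $1\le j\le N$, $e=\hat\alpha/\hat\sigma-\alpha^*/\sigma^*\in\mathbb R^N$, and $\omega=\frac1{2+2\exp(2\bar c)}$. Statements about $e$ with a probability are meant for all MLEs simultaneously. (a) Suppose $\lambda_{\min}(\Sigma_D)=\bar\lambda>0$. For every $\delta\in(0,1)$, with probability at least $1-\delta$, $$\|e\|_\infty\le\|e\|_2\le \frac{2}{\sqrt{\bar\lambda}}\sqrt{\frac{N-1+2\sqrt{-(N-1)\log\delta}-2\log\delta}{\omega^2K}},$$ and for all $N\ge2$, $K\ge 1$ the right-hand side is at most $C\sqrt{N/K}$ with $C$ depending only on $\bar c,\bar\lambda,\delta$. Furthermore: (a.1)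 for each fixed $N$, each $\bar\lambda>0$ and $\delta\in(0,1)$ there is $C$, depending only on $\bar c,\bar\lambda,\delta,N$, such that for all $K\ge1$ and all $K$ queries with $N$ breakpoints and $\lambda_{\min}(\Sigma_D)\ge\bar\lambda$, with probability at least $1-\delta$, $\|e\|_\infty\le\|e\|_2\le C/\sqrt K$; (a.2) for a fixed decision maker, along any sequence of sets of queries whose number of queries $K$ tends to infinity, with $\lambda_{\min}(\Sigma_D)\ge\bar\lambda$ eventually for a fixed $\bar\lambda>0$, and with $N=o(K)$, the errors $\|e\|_\infty\le\|e\|_2$ converge to $0$ in probability. (b) Suppose $\lambda_{\min}(\Sigma_D)=0$ (so $\Sigma_D$ is rank-deficient). For every $\lambda>0$ and $\delta\in(0,1)$, with probability at least $1-\delta$, $$\|e\|_\infty\le\|e\|_2\le \frac{2}{\sqrt{\lambda}}\sqrt{\frac{N-1+2\sqrt{-(N-1)\log\delta}-2\log\delta}{\omega^2K}+\lambda\bigl(\bar c\sqrt{N-1}\bigr)^2},$$ and for all $N\ge2$, $K\ge1$ the right-hand side is at most $C_1\sqrt{N/K}+C_2\,\bar c\sqrt N$ with $C_1$ depending only on $\bar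 c,\lambda,\delta$ and $C_2$ a universal constant. In this case the error may fail to converge to zero: for every $\bar c>0$ there are a decision maker, two different lotteries $W,Y$, and $\eta,\rho>0$ such that, if the query $(W,Y)$ is repeated $K$ times, then for every $K\ge1$ one has $\lambda_{\min}(\Sigma_D)=0$ and, with probability at least $\rho$, there is an MLE with $\|e\|_\infty\ge\eta$. -/

import Mathlib

open scoped ENNReal NNReal Topology
open MeasureTheory ProbabilityTheory Filter

universe v

noncomputable section

/-- The utility functions on `[0, b]` that are increasing, concave, Lipschitz with modulus at
most `L`, and normalised by `u 0 = 0`, `u b = 1`. (Only the values on `[0, b]` matter.) -/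
def vnmUtilities (b : ℝ) (L : ℝ≥0) : Set (ℝ → ℝ) :=
  {u | MonotoneOn u (Set.Icc 0 b) ∧ ConcaveOn ℝ (Set.Icc 0 b) u ∧
    LipschitzOnWith L u (Set.Icc 0 b) ∧ u 0 = 0 ∧ u b = 1}

/-- The decision maker: largest outcome `b`, Lipschitz bound `L`, true utility function `u` and
true scale parameter `σ ≥ 1 / cbar` of the response error. -/
structure DecisionMaker (cbar : ℝ) where
  b : ℝ
  b_pos : 0 < b
  L : ℝ≥0
  u : ℝ → ℝ
  u_mem : u ∈ vnmUtilities b L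
  σ : ℝ
  le_σ : 1 / cbar ≤ σ

/-- A lottery with finitely many outcomes in `[0, b]`, given by its distribution. -/
structure Lottery (b : ℝ) where
  law : PMF ℝ
  finite : law.support.Finite
  mem_Icc : law.support ⊆ Set.Icc 0 b

namespace Lottery

variable {b : ℝ}

/-- The probability of the outcome `y`. -/
def prob (X : Lottery b) (y : ℝ) : ℝ := (X.law y).toReal

/-- The expected utility `𝔼[u(X)]`. -/
def expect (X : Lottery b) (u : ℝ → ℝ) : ℝ := ∑ y ∈ X.finite.toFinset, X.prob y * u y

end Lottery

/-- The pairs of lotteries `(W k, Y k)` of the `K` pairwise comparison queries. -/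
structure Queries (b : ℝ) (K : ℕ) where
  W : Fin K → Lottery b
  Y : Fin K → Lottery b

namespace Queries

variable {b : ℝ} {K : ℕ}

/-- The support set: `0`, `b`, and all outcomes of all lotteries. -/
def supportSet (D : Queries b K) : Finset ℝ :=
  {0, b} ∪ Finset.univ.biUnion fun k => (D.W k).finite.toFinset ∪ (D.Y k).finite.toFinset

/-- The number of breakpoints. -/
def N (D : Queries b K) : ℕ := D.supportSet.card

/-- The breakpoints in increasing order (numbered from `0` to `N - 1`). -/
def y (D : Queries b K) (j : Fin D.N) : ℝ := D.supportSet.orderEmbOfFin rfl j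

/-- The probability-mass difference vectors. -/
def p (D : Queries b K) (k : Fin K) (j : Fin D.N) : ℝ :=
  (D.W k).prob (D.y j) - (D.Y k).prob (D.y j)

/-- The reduced matrix, whose `k`-th row is the difference vector of query `k` without its entry at
the first breakpoint. -/
def P (D : Queries b K) : Matrix (Fin K) (Fin (D.N - 1)) ℝ :=
  Matrix.of fun k j => D.p k ⟨j.1 + 1, by have := j.2; omega⟩

/-- The empirical information matrix. -/
def infoMatrix (D : Queries b K) : Matrix (Fin (D.N - 1)) (Fin (D.N - 1)) ℝ :=
  (1 / (K : ℝ)) • (D.P.transpose * D.P)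

/-- The difference of the expected utilities of the two lotteries of query `k`. -/
def utilityGap (D : Queries b K) (u : ℝ → ℝ) (k : Fin K) : ℝ :=
  (D.W k).expect u - (D.Y k).expect u

/-- The log-likelihood of the choices `z k ∈ {1, -1}`. The scale may be `∞`, and then `1 / σ = 0`. -/
def logLik (D : Queries b K) (z : Fin K → ℝ) (u : ℝ → ℝ) (σ : ℝ≥0∞) : ℝ :=
  ∑ k, Real.log (1 / (1 + Real.exp (-(z k) * D.utilityGap u k * (σ⁻¹).toReal)))

/-- `(u, σ)` maximises the log-likelihood over all admissible utility functions and all scales in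
`[1 / cbar, ∞]`. -/
def IsMLE (D : Queries b K) (L : ℝ≥0) (cbar : ℝ) (z : Fin K → ℝ) (u : ℝ → ℝ) (σ : ℝ≥0∞) : Prop :=
  u ∈ vnmUtilities b L ∧ ENNReal.ofReal (1 / cbar) ≤ σ ∧
    ∀ u' ∈ vnmUtilities b L, ∀ σ' : ℝ≥0∞, ENNReal.ofReal (1 / cbar) ≤ σ' →
      D.logLik z u' σ' ≤ D.logLik z u σ

/-- The queries in which one pair of lotteries is presented `K` times. -/
def repeated (W Y : Lottery b) (K : ℕ) : Queries b K := ⟨fun _ => W, fun _ => Y⟩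

end Queries

/-- The smallest eigenvalue (of a symmetric matrix of positive size). -/
def lambdaMin {n : ℕ} (A : Matrix (Fin n) (Fin n) ℝ) : ℝ := sInf (spectrum ℝ A)

/-- The Gumbel distribution with location `0` and scale `σ`, through its density. -/
def gumbel (σ : ℝ) : Measure ℝ :=
  volume.withDensity fun x =>
    ENNReal.ofReal (1 / σ * Real.exp (-x / σ) * Real.exp (-Real.exp (-x / σ)))

namespace DecisionMaker

variable {cbar : ℝ} {K : ℕ}

/-- `Z` are the decision maker's choices in the queries `D`: each of the two lotteries of each query
gets the random utility "expected utility plus response error", the response errors are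
i.i.d. Gumbel, and `W k` is chosen (`Z k = 1`) iff its random utility is at least that of `Y k`. -/
def IsChoice (M : DecisionMaker cbar) (D : Queries M.b K) {Ω : Type*} [MeasurableSpace Ω]
    (μ : Measure Ω) (Z : Fin K → Ω → ℝ) : Prop :=
  ∃ ε : Fin K × Fin 2 → Ω → ℝ,
    (∀ i, Measurable (ε i)) ∧ (∀ i, μ.map (ε i) = gumbel M.σ) ∧ iIndepFun ε μ ∧
    ∀ k ω, Z k ω =
      if (D.Y k).expect M.u + ε (k, 1) ω ≤ (D.W k).expect M.u + ε (k, 0) ω then 1 else -1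

/-- The estimation error `α̂ / σ̂ - α / σ` at the breakpoints; its norm is the `ℓ_∞` error. -/
def error (M : DecisionMaker cbar) (D : Queries M.b K) (u : ℝ → ℝ) (σ : ℝ≥0∞) : Fin D.N → ℝ :=
  fun j => u (D.y j) * (σ⁻¹).toReal - M.u (D.y j) / M.σ

/-- The `ℓ_∞` error. -/
def errorSup (M : DecisionMaker cbar) (D : Queries M.b K) (u : ℝ → ℝ) (σ : ℝ≥0∞) : ℝ :=
  ‖M.error D u σ‖

/-- The `ℓ₂` error. -/
def errorTwo (M : DecisionMaker cbar) (D : Queries M.b K) (u : ℝ → ℝ) (σ : ℝ≥0∞) : ℝ :=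
  ‖WithLp.toLp 2 (M.error D u σ)‖

/-- The event that, for every maximum likelihood estimate, the `ℓ_∞` error is at most the
`ℓ₂` error, and the latter is at most `r`. -/
def errorEvent (M : DecisionMaker cbar) (D : Queries M.b K) {Ω : Type*}
    (Z : Fin K → Ω → ℝ) (r : ℝ) : Set Ω :=
  {ω | ∀ (u : ℝ → ℝ) (σ : ℝ≥0∞), D.IsMLE M.L cbar (fun k => Z k ω) u σ →
    M.errorSup D u σ ≤ M.errorTwo D u σ ∧ M.errorTwo D u σ ≤ r}

end DecisionMaker

/-- The constant `ω = 1 / (2 + 2 exp (2 cbar))`. -/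
def omegaConst (cbar : ℝ) : ℝ := 1 / (2 + 2 * Real.exp (2 * cbar))

/-- `(N - 1 + 2 √(-(N - 1) log δ) - 2 log δ) / (ω² K)`. -/
def varTerm (cbar δ : ℝ) (N K : ℕ) : ℝ :=
  (((N : ℝ) - 1) + 2 * √(-((N : ℝ) - 1) * Real.log δ) - 2 * Real.log δ) /
    (omegaConst cbar ^ 2 * K)

/-- The error bound for a full-rank information matrix with smallest eigenvalue `lam`. -/
def boundFull (cbar lam δ : ℝ) (N K : ℕ) : ℝ := 2 / √lam * √(varTerm cbar δ N K)

/-- The error bound for a rank-deficient information matrix, with regularisation `lam`. -/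
def boundDeficient (cbar lam δ : ℝ) (N K : ℕ) : ℝ :=
  2 / √lam * √(varTerm cbar δ N K + lam * (cbar * √((N : ℝ) - 1)) ^ 2)

end

/-! Write `t_k` for the utility gap of query `k` divided by the scale, and `B_k` for the indicator
of `Z_k = 1`. The log-likelihood is the sum of `B_k t_k - log (1 + exp t_k)`, and admissible `t_k`
lie in `[-cbar, cbar]`, where softplus is `ω`-strongly convex. Let `x` be the error without its
first entry, which is zero, and let `V_k = B_k - sigmoid t*_k` be the residual at the truth. As the
truth is itself admissible, every MLE satisfies `(ω/2) ‖P x‖² ≤ ⟨V, P x⟩`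
(`sum_sq_mulVec_reducedError_le`). With `Π` the projection onto the column space of `P`, of
dimension `d ≤ N - 1`, Cauchy-Schwarz gives `ω² ‖P x‖² ≤ 4 ‖Π V‖²`, and `‖P x‖² = K xᵀ Σ_D x ≥ K λ
‖x‖²`. The right-hand side does not involve the MLE, so one event serves all of them.

The difference of two Gumbel errors is logistic, so the `V_k` are centred; they are independent with
range one, hence sub-Gaussian with variance proxy `1/4`. Gaussian linearisation of the square and
Markov's inequality (`measure_quadratic_gt_le`) give `‖Π V‖² ≤ d - 2 log δ` with probability at
least `1 - δ`, slightly better than needed. The rates follow by AM-GM.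

The bound in (b) holds surely: error entries lie in `[-cbar, cbar]`, so `‖e‖₂ ≤ cbar √(N - 1)`, and
the regularisation term alone exceeds this. For the failure of consistency, sure `1` is compared
with sure `0` on `[0, 2]`: the likelihood sees only `u 1 / σ`, so `min x 1` with a suitable scale is
always an MLE, although the true utility is linear. -/

noncomputable section

/-! ### The logistic function and the Gumbel distribution -/

/-- The softplus function is `ω`-strongly convex on `[-c, c]`: quadratic lower bound. -/
lemma softplus_quadratic_lower_bound {c x y : ℝ} (hx : x ∈ Set.Icc (-c) c)
    (hy : y ∈ Set.Icc (-c) c) :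
    Real.log (1 + Real.exp x) + Real.sigmoid x * (y - x) + omegaConst c / 2 * (y - x) ^ 2
      ≤ Real.log (1 + Real.exp y) := by
  have hc : 0 ≤ c := by linarith [hx.1.trans hx.2]
  have hd : ∀ t : ℝ, HasDerivAt (fun t => Real.log (1 + Real.exp t)) (Real.sigmoid t) t := by
    intro t
    have h := ((Real.hasDerivAt_exp t).const_add 1).log (by positivity)
    convert h using 1
    rw [Real.sigmoid_def, Real.exp_neg]
    field_simp
    ring
  have hk : ∀ t : ℝ, HasDerivAt
      (fun t => Real.log (1 + Real.exp t) - omegaConst c / 2 * t ^ 2)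
      (Real.sigmoid t - omegaConst c * t) t := by
    intro t
    refine ((hd t).sub ((hasDerivAt_pow 2 t).const_mul (omegaConst c / 2))).congr_deriv ?_
    simp
    ring
  have hk2 : ∀ t : ℝ, HasDerivAt (fun t => Real.sigmoid t - omegaConst c * t)
      (Real.sigmoid t * (1 - Real.sigmoid t) - omegaConst c) t := by
    intro t
    refine ((Real.hasDerivAt_sigmoid t).sub
      ((hasDerivAt_id t).const_mul (omegaConst c))).congr_deriv ?_
    simp
  -- The curvature is `1 / (2 + exp t + exp (-t))`; bounding each exponential by `exp (2 * c)` gives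
  -- exactly `ω`.
  have hcurv : ∀ t ∈ Set.Icc (-c) c,
      0 ≤ Real.sigmoid t * (1 - Real.sigmoid t) - omegaConst c := by
    intro t ht
    have h1 : Real.exp t ≤ Real.exp (2 * c) := Real.exp_le_exp.2 (by linarith [ht.2])
    have h2 : Real.exp (-t) ≤ Real.exp (2 * c) := Real.exp_le_exp.2 (by linarith [ht.1])
    have h3 : Real.sigmoid t * (1 - Real.sigmoid t) = 1 / (2 + Real.exp t + Real.exp (-t)) := by
      rw [← Real.sigmoid_neg, Real.sigmoid_def, Real.sigmoid_def, neg_neg, ← mul_inv, one_div]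
      congr 1
      have : Real.exp (-t) * Real.exp t = 1 := by rw [← Real.exp_add]; simp
      linear_combination this
    rw [h3, sub_nonneg, omegaConst]
    apply one_div_le_one_div_of_le (by positivity)
    linarith
  have hmono : MonotoneOn (fun t => Real.sigmoid t - omegaConst c * t) (Set.Icc (-c) c) := by
    apply monotoneOn_of_deriv_nonneg (convex_Icc _ _)
    · exact fun t _ => (hk2 t).continuousAt.continuousWithinAt
    · exact fun t _ => (hk2 t).differentiableAt.differentiableWithinAt
    · intro t ht
      rw [(hk2 t).deriv]
      exact hcurv t (interior_subset ht)
  have hconv : ConvexOn ℝ (Set.Icc (-c) c)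
      (fun t => Real.log (1 + Real.exp t) - omegaConst c / 2 * t ^ 2) := by
    apply MonotoneOn.convexOn_of_deriv (convex_Icc _ _)
    · exact fun t _ => (hk t).continuousAt.continuousWithinAt
    · exact fun t _ => (hk t).differentiableAt.differentiableWithinAt
    · have : deriv (fun t => Real.log (1 + Real.exp t) - omegaConst c / 2 * t ^ 2)
          = fun t => Real.sigmoid t - omegaConst c * t := funext fun t => (hk t).deriv
      rw [this]
      exact hmono.mono interior_subset
  -- Tangent line bound for the convex function softplus minus `ω/2 t²`.
  have key : Real.log (1 + Real.exp x) - omegaConst c / 2 * x ^ 2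
      + (Real.sigmoid x - omegaConst c * x) * (y - x)
      ≤ Real.log (1 + Real.exp y) - omegaConst c / 2 * y ^ 2 := by
    rcases lt_trichotomy x y with h | h | h
    · have := hconv.le_slope_of_hasDerivAt hx hy h (hk x)
      rw [slope_def_field, le_div_iff₀ (by linarith)] at this
      linarith
    · subst h; simp
    · have := hconv.slope_le_of_hasDerivAt hy hx h (hk x)
      rw [slope_def_field, div_le_iff₀ (by linarith)] at this
      linarith
  linarith

/-- An antiderivative of the Gumbel density weighted by a power of its distribution function. -/
lemma hasDerivAt_gumbel_antideriv {σ a : ℝ} (ha : a ≠ 0) (x : ℝ) :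
    HasDerivAt (fun x => Real.exp (-(a * Real.exp (-x / σ))) / a)
      (1 / σ * Real.exp (-x / σ) * Real.exp (-(a * Real.exp (-x / σ)))) x := by
  have h := (((((hasDerivAt_id x).neg.div_const σ).exp.const_mul a).neg).exp.div_const a)
  refine h.congr_deriv ?_
  simp only [Pi.neg_apply, id]
  field_simp

/-- The weight `a = 1` gives the distribution function, and `a = 1 + exp (-c / σ)` the law of a
difference of two Gumbel variables. -/
lemma lintegral_gumbel_weight {σ a : ℝ} (hσ : 0 < σ) (ha : 0 < a) :
    ∫⁻ x, ENNReal.ofReal (1 / σ * Real.exp (-x / σ) * Real.exp (-(a * Real.exp (-x / σ))))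
      = ENNReal.ofReal (1 / a) ∧
    ∀ c, ∫⁻ x in Set.Iic c,
      ENNReal.ofReal (1 / σ * Real.exp (-x / σ) * Real.exp (-(a * Real.exp (-x / σ))))
      = ENNReal.ofReal (Real.exp (-(a * Real.exp (-c / σ))) / a) := by
  have hnn : ∀ x : ℝ,
      0 ≤ 1 / σ * Real.exp (-x / σ) * Real.exp (-(a * Real.exp (-x / σ))) := by
    intro x; positivity
  have hneg : Tendsto (fun x : ℝ => -x / σ) atBot atTop :=
    (tendsto_neg_atBot_atTop).atTop_div_const hσ
  have hpos : Tendsto (fun x : ℝ => -x / σ) atTop atBot :=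
    (tendsto_neg_atTop_atBot).atBot_div_const hσ
  have hbot : Tendsto (fun x => Real.exp (-(a * Real.exp (-x / σ))) / a) atBot (𝓝 0) := by
    have : Tendsto (fun x => -(a * Real.exp (-x / σ))) atBot atBot :=
      tendsto_neg_atTop_atBot.comp ((Real.tendsto_exp_atTop.comp hneg).const_mul_atTop ha)
    simpa using (Real.tendsto_exp_atBot.comp this).div_const a
  have htop : Tendsto (fun x => Real.exp (-(a * Real.exp (-x / σ))) / a) atTop (𝓝 (1 / a)) := by
    have : Tendsto (fun x => -(a * Real.exp (-x / σ))) atTop (𝓝 (-(a * 0))) :=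
      ((Real.tendsto_exp_atBot.comp hpos).const_mul a).neg
    have h := ((Real.continuous_exp.tendsto _).comp this).div_const a
    simpa using h
  have hd := fun x => hasDerivAt_gumbel_antideriv (σ := σ) ha.ne' x
  have hint : Integrable
      (fun x => 1 / σ * Real.exp (-x / σ) * Real.exp (-(a * Real.exp (-x / σ)))) := by
    refine integrable_of_intervalIntegral_norm_bounded (l := atTop) (a := fun n : ℝ => -n)
      (b := fun n => n) (1 / a) (fun n => ?_) tendsto_neg_atTop_atBot tendsto_id ?_
    · exact (by fun_prop : Continuous fun x => 1 / σ * Real.exp (-x / σ) *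
        Real.exp (-(a * Real.exp (-x / σ)))).integrableOn_Ioc
    · refine Eventually.of_forall fun n => ?_
      simp_rw [Real.norm_eq_abs, abs_of_nonneg (hnn _)]
      rw [intervalIntegral.integral_eq_sub_of_hasDerivAt (fun x _ => hd x)
        ((by fun_prop : Continuous fun x => 1 / σ * Real.exp (-x / σ) *
        Real.exp (-(a * Real.exp (-x / σ)))).intervalIntegrable _ _)]
      have h1 : 0 ≤ Real.exp (-(a * Real.exp (- -n / σ))) / a := by positivity
      have h2 : Real.exp (-(a * Real.exp (-n / σ))) ≤ 1 :=
        Real.exp_le_one_iff.2 (neg_nonpos.2 (by positivity))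
      have h3 := div_le_div_of_nonneg_right h2 ha.le
      linarith
  refine ⟨?_, fun c => ?_⟩
  · rw [← ofReal_integral_eq_lintegral_ofReal hint (ae_of_all _ hnn),
      integral_of_hasDerivAt_of_tendsto hd hint hbot htop, sub_zero]
  · rw [← ofReal_integral_eq_lintegral_ofReal hint.integrableOn (ae_of_all _ hnn),
      integral_Iic_of_hasDerivAt_of_tendsto' (fun x _ => hd x) hint.integrableOn hbot, sub_zero]

lemma gumbel_Iic {σ : ℝ} (hσ : 0 < σ) (c : ℝ) :
    gumbel σ (Set.Iic c) = ENNReal.ofReal (Real.exp (-Real.exp (-c / σ))) := by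
  have h := (lintegral_gumbel_weight hσ one_pos).2 c
  simp only [one_mul, div_one] at h
  rw [gumbel, withDensity_apply _ measurableSet_Iic, h]

/-- The difference of two independent Gumbel variables is logistic. -/
lemma gumbel_prod_le {σ : ℝ} (hσ : 0 < σ) [SFinite (gumbel σ)] (c : ℝ) :
    ((gumbel σ).prod (gumbel σ)) {q : ℝ × ℝ | q.2 ≤ q.1 + c}
      = ENNReal.ofReal (Real.sigmoid (c / σ)) := by
  have hm : MeasurableSet {q : ℝ × ℝ | q.2 ≤ q.1 + c} :=
    measurableSet_le measurable_snd (measurable_fst.add_const c)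
  rw [Measure.prod_apply hm]
  have h1 : ∀ x : ℝ, gumbel σ (Prod.mk x ⁻¹' {q : ℝ × ℝ | q.2 ≤ q.1 + c})
      = ENNReal.ofReal (Real.exp (-Real.exp (-(x + c) / σ))) := fun x => gumbel_Iic hσ (x + c)
  simp_rw [h1]
  rw [gumbel, lintegral_withDensity_eq_lintegral_mul _ (by fun_prop) (by fun_prop)]
  -- The Gumbel density at `x` times the distribution function at `x + c` is again a weighted
  -- density, with this weight.
  have ha : 0 < 1 + Real.exp (-(c / σ)) := by positivity
  have h2 := (lintegral_gumbel_weight hσ ha).1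
  rw [one_div (1 + _)] at h2
  rw [Real.sigmoid_def, ← h2]
  refine lintegral_congr fun x => ?_
  simp only [Pi.mul_apply]
  rw [← ENNReal.ofReal_mul (by positivity), mul_assoc _ (Real.exp (-Real.exp _)), ← Real.exp_add]
  congr 3
  rw [show -(x + c) / σ = -x / σ + -(c / σ) by ring, Real.exp_add]
  ring

/-- Grouping independent variables indexed by a product gives independent blocks. -/
lemma iIndepFun_curry {Ω ι κ : Type*} [Countable ι] [Countable κ] [MeasurableSpace Ω]
    {μ : Measure Ω}
    {ε : ι × κ → Ω → ℝ} (hm : ∀ i, Measurable (ε i)) (hε : iIndepFun ε μ) :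
    iIndepFun (fun i ω j => ε (i, j) ω) μ := by
  have := hε.isProbabilityMeasure
  have hp : ∀ i j, IsProbabilityMeasure (μ.map (ε (i, j))) :=
    fun i j => Measure.isProbabilityMeasure_map (hm _).aemeasurable
  rw [iIndepFun_iff_map_fun_eq_infinitePi_map (fun i => by fun_prop)]
  have h1 : ∀ i, μ.map (fun ω j => ε (i, j) ω)
      = Measure.infinitePi (fun j => μ.map (ε (i, j))) := fun i =>
    (hε.precomp (g := fun j => (i, j)) (Prod.mk_right_injective i)).map_fun_eq_infinitePi_map
      (fun j => hm _)
  simp_rw [h1]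
  rw [← Measure.infinitePi_map_curry (fun i j => μ.map (ε (i, j))),
    ← hε.map_fun_eq_infinitePi_map hm, Measure.map_map (by fun_prop) (by fun_prop)]
  rfl

/-! ### Tails of quadratic forms in independent sub-Gaussian variables -/

/-- Used from right to left, it turns the exponential of a square into a Gaussian average of
exponentials of linear forms. -/
lemma lintegral_exp_mul_gaussianReal (x : ℝ) :
    ∫⁻ g, ENNReal.ofReal (Real.exp (x * g)) ∂(gaussianReal 0 1)
      = ENNReal.ofReal (Real.exp (x ^ 2 / 2)) := by
  rw [← ofReal_integral_eq_lintegral_ofReal (integrable_exp_mul_gaussianReal x)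
    (ae_of_all _ fun _ => (Real.exp_pos _).le)]
  congr 1
  have := congrFun (mgf_id_gaussianReal (μ := 0) (v := 1)) x
  simpa [mgf] using this

/-- The exact value is `√(4/3)`; the cruder `exp (1/2)` per dimension is what produces the term `d`
in the tail bound. -/
lemma lintegral_exp_sq_gaussianReal_le :
    ∫⁻ g, ENNReal.ofReal (Real.exp (g ^ 2 / 8)) ∂(gaussianReal 0 1)
      ≤ ENNReal.ofReal (Real.exp (1 / 2)) := by
  rw [gaussianReal_of_var_ne_zero _ one_ne_zero,
    lintegral_withDensity_eq_lintegral_mul _ (by fun_prop) (by fun_prop)]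
  have h1 : ∀ x : ℝ, (gaussianPDF 0 1 * fun g => ENNReal.ofReal (Real.exp (g ^ 2 / 8))) x
      = ENNReal.ofReal ((√(2 * Real.pi))⁻¹ * Real.exp (-(3 / 8) * x ^ 2)) := by
    intro x
    simp only [Pi.mul_apply, gaussianPDF, gaussianPDFReal]
    rw [← ENNReal.ofReal_mul (by positivity), mul_assoc, ← Real.exp_add]
    simp only [NNReal.coe_one, mul_one, sub_zero]
    ring_nf
  simp_rw [h1]
  rw [← ofReal_integral_eq_lintegral_ofReal
    ((integrable_exp_neg_mul_sq (by norm_num)).const_mul _)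
    (ae_of_all _ fun _ => by positivity), integral_const_mul, integral_gaussian,
    ← Real.sqrt_inv, ← Real.sqrt_mul (by positivity)]
  apply ENNReal.ofReal_le_ofReal
  have h2 : (2 * Real.pi)⁻¹ * (Real.pi / (3 / 8)) = 4 / 3 := by
    have := Real.pi_pos.ne'
    field_simp
    norm_num
  rw [h2]
  apply Real.sqrt_le_iff.2 ⟨by positivity, ?_⟩
  rw [← Real.exp_nat_mul]
  have := Real.add_one_le_exp 1
  norm_num
  linarith

lemma lintegral_pi_prod {ι : Type*} [Fintype ι] (ν : Measure ℝ) [IsProbabilityMeasure ν]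
    {f : ι → ℝ → ℝ≥0∞} (hf : ∀ i, Measurable (f i)) :
    ∫⁻ g, ∏ i, f i (g i) ∂(Measure.pi fun _ : ι => ν) = ∏ i, ∫⁻ x, f i x ∂ν := by
  have h : iIndepFun (fun i (g : ι → ℝ) => f i (g i)) (Measure.pi fun _ : ι => ν) :=
    iIndepFun_pi (fun i => (hf i).aemeasurable)
  rw [lintegral_prod_eq_prod_lintegral_of_indepFun Finset.univ _ h
    (fun i => (hf i).comp (measurable_pi_apply i))]
  refine Finset.prod_congr rfl fun i _ => ?_
  exact (measurePreserving_eval (fun _ : ι => ν) i).lintegral_comp (hf i)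

section QuadraticForm

variable {Ω : Type*} [MeasurableSpace Ω] {μ : Measure Ω}
  {κ ι : Type*} [Fintype κ] [Fintype ι]

lemma lintegral_exp_sum_le {V : κ → Ω → ℝ}
    (hindep : iIndepFun V μ) (hV : ∀ k, HasSubgaussianMGF (V k) (1 / 4) μ) (w : κ → ℝ) :
    ∫⁻ ω, ENNReal.ofReal (Real.exp (∑ k, w k * V k ω)) ∂μ
      ≤ ENNReal.ofReal (Real.exp ((∑ k, w k ^ 2) / 8)) := by
  have h := HasSubgaussianMGF.sum_of_iIndepFun
    (hindep.comp (fun k x => w k * x) (fun k => by fun_prop))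
    (s := Finset.univ) (fun k _ => (hV k).const_mul (w k))
  have hi := h.integrable_exp_mul 1
  have hm := h.mgf_le 1
  simp only [mgf, one_mul, Function.comp] at hi hm
  rw [← ofReal_integral_eq_lintegral_ofReal hi (ae_of_all _ fun _ => (Real.exp_pos _).le)]
  apply ENNReal.ofReal_le_ofReal
  refine hm.trans (Real.exp_le_exp.2 (le_of_eq ?_))
  rw [NNReal.coe_sum, one_pow, mul_one, Finset.sum_div, Finset.sum_div]
  refine Finset.sum_congr rfl fun k _ => ?_
  change w k ^ 2 * ((1 / 4 : ℝ≥0) : ℝ) / 2 = _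
  push_cast
  ring

/-- Linearise each square with an independent standard Gaussian `g i` and exchange the integrals.
For fixed `g` the sub-Gaussian bound applies to the weights `∑ g i • q i`, whose squared norm is `∑
g i ^ 2` by orthonormality; the Gaussian integral then factorises. -/
lemma lintegral_exp_quadratic_le {V : κ → Ω → ℝ} (hm : ∀ k, Measurable (V k))
    (hindep : iIndepFun V μ) (hV : ∀ k, HasSubgaussianMGF (V k) (1 / 4) μ)
    {q : ι → EuclideanSpace ℝ κ} (hq : Orthonormal ℝ q) :
    ∫⁻ ω, ENNReal.ofReal (Real.exp ((∑ i, (∑ k, q i k * V k ω) ^ 2) / 2)) ∂μ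
      ≤ ENNReal.ofReal (Real.exp (Fintype.card ι / 2)) := by
  have := hindep.isProbabilityMeasure
  set γ : Measure (ι → ℝ) := Measure.pi fun _ => gaussianReal 0 1
  have h1 : ∀ ω, ENNReal.ofReal (Real.exp ((∑ i, (∑ k, q i k * V k ω) ^ 2) / 2))
      = ∫⁻ g, ENNReal.ofReal (Real.exp (∑ k, (∑ i, g i * q i k) * V k ω)) ∂γ := by
    intro ω
    have : ∀ g : ι → ℝ, ENNReal.ofReal (Real.exp (∑ k, (∑ i, g i * q i k) * V k ω))
        = ∏ i, ENNReal.ofReal (Real.exp ((∑ k, q i k * V k ω) * g i)) := by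
      intro g
      rw [← ENNReal.ofReal_prod_of_nonneg fun _ _ => (Real.exp_pos _).le, ← Real.exp_sum]
      congr 2
      simp_rw [Finset.sum_mul]
      rw [Finset.sum_comm]
      exact Finset.sum_congr rfl fun i _ => Finset.sum_congr rfl fun k _ => by ring
    simp_rw [this]
    rw [lintegral_pi_prod _ (f := fun i x =>
      ENNReal.ofReal (Real.exp ((∑ k, q i k * V k ω) * x))) (fun i => by fun_prop)]
    simp_rw [lintegral_exp_mul_gaussianReal]
    rw [← ENNReal.ofReal_prod_of_nonneg fun _ _ => (Real.exp_pos _).le, ← Real.exp_sum,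
      Finset.sum_div]
  simp_rw [h1]
  rw [lintegral_lintegral_swap (by fun_prop)]
  have h2 : ∀ g : ι → ℝ, ∑ k, (∑ i, g i * q i k) ^ 2 = ∑ i, g i ^ 2 := by
    intro g
    have h := hq.inner_sum g g Finset.univ
    rw [real_inner_self_eq_norm_sq, EuclideanSpace.norm_sq_eq] at h
    simpa [pow_two] using h
  calc _ ≤ ∫⁻ g, ENNReal.ofReal (Real.exp ((∑ i, g i ^ 2) / 8)) ∂γ := by
        refine lintegral_mono fun g => ?_
        rw [← h2 g]
        exact lintegral_exp_sum_le hindep hV _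
    _ = ∏ i : ι, ∫⁻ x, ENNReal.ofReal (Real.exp (x ^ 2 / 8)) ∂(gaussianReal 0 1) := by
        rw [← lintegral_pi_prod _ (fun i => by fun_prop)]
        refine lintegral_congr fun g => ?_
        rw [← ENNReal.ofReal_prod_of_nonneg fun _ _ => (Real.exp_pos _).le, ← Real.exp_sum,
          Finset.sum_div]
    _ ≤ ∏ i : ι, ENNReal.ofReal (Real.exp (1 / 2)) :=
        Finset.prod_le_prod' fun i _ => lintegral_exp_sq_gaussianReal_le
    _ = _ := by
        rw [Finset.prod_const, ← ENNReal.ofReal_pow (Real.exp_pos _).le, ← Real.exp_nat_mul,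
          Finset.card_univ]
        congr 2
        ring

/-- Tail bound for the squared norm of the projection, onto a space with orthonormal basis `q`, of a
vector of independent centred variables of range at most one. -/
lemma measure_quadratic_gt_le {V : κ → Ω → ℝ} (hm : ∀ k, Measurable (V k))
    (hindep : iIndepFun V μ) (hV : ∀ k, HasSubgaussianMGF (V k) (1 / 4) μ)
    {q : ι → EuclideanSpace ℝ κ} (hq : Orthonormal ℝ q) (t : ℝ) :
    μ {ω | Fintype.card ι + 2 * t < ∑ i, (∑ k, q i k * V k ω) ^ 2}
      ≤ ENNReal.ofReal (Real.exp (-t)) := by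
  have h := lintegral_exp_quadratic_le hm hindep hV hq
  have hmk := mul_meas_ge_le_lintegral₀ (μ := μ)
    (f := fun ω => ENNReal.ofReal (Real.exp ((∑ i, (∑ k, q i k * V k ω) ^ 2) / 2)))
    (by fun_prop) (ENNReal.ofReal (Real.exp (Fintype.card ι / 2 + t)))
  have hsub : {ω | Fintype.card ι + 2 * t < ∑ i, (∑ k, q i k * V k ω) ^ 2} ⊆
      {ω | ENNReal.ofReal (Real.exp (Fintype.card ι / 2 + t))
        ≤ ENNReal.ofReal (Real.exp ((∑ i, (∑ k, q i k * V k ω) ^ 2) / 2))} := by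
    intro ω hω
    simp only [Set.mem_ofPred_eq] at hω ⊢
    exact ENNReal.ofReal_le_ofReal (Real.exp_le_exp.2 (by linarith))
  refine (measure_mono hsub).trans ?_
  have h3 := hmk.trans h
  rw [mul_comm, ← ENNReal.le_div_iff_mul_le (by simp [Real.exp_pos]) (by simp),
    ← ENNReal.ofReal_div_of_pos (Real.exp_pos _), ← Real.exp_sub] at h3
  exact h3.trans_eq (by ring_nf)

end QuadraticForm

/-! ### Breakpoints and expected utilities -/

namespace Lottery

variable {b : ℝ} (X : Lottery b)

lemma expect_eq_sum {s : Finset ℝ} (hs : X.finite.toFinset ⊆ s) (u : ℝ → ℝ) :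
    X.expect u = ∑ y ∈ s, X.prob y * u y := by
  refine Finset.sum_subset hs fun y _ hy => ?_
  have : X.law y = 0 := by simpa using hy
  simp [prob, this]

lemma sum_prob : ∑ y ∈ X.finite.toFinset, X.prob y = 1 := by
  have h := X.law.tsum_coe
  rw [tsum_eq_sum (s := X.finite.toFinset) (fun y hy => by simpa using hy)] at h
  simp only [prob]
  rw [← ENNReal.toReal_sum fun y _ => X.law.apply_ne_top y, h, ENNReal.toReal_one]

lemma expect_mem_Icc {u : ℝ → ℝ} (hu : ∀ y ∈ Set.Icc 0 b, u y ∈ Set.Icc 0 1) :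
    X.expect u ∈ Set.Icc 0 1 := by
  have h : ∀ y ∈ X.finite.toFinset, u y ∈ Set.Icc 0 1 := fun y hy =>
    hu y (X.mem_Icc (by simpa using hy))
  constructor
  · exact Finset.sum_nonneg fun y hy => mul_nonneg ENNReal.toReal_nonneg (h y hy).1
  · rw [← X.sum_prob]
    exact Finset.sum_le_sum fun y hy =>
      mul_le_of_le_one_right ENNReal.toReal_nonneg (h y hy).2

end Lottery

lemma mem_Icc_of_mem_vnmUtilities {b : ℝ} (hb : 0 < b) {L : ℝ≥0} {u : ℝ → ℝ}
    (hu : u ∈ vnmUtilities b L) {y : ℝ} (hy : y ∈ Set.Icc 0 b) : u y ∈ Set.Icc 0 1 := by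
  obtain ⟨hm, -, -, h0, h1⟩ := hu
  exact ⟨h0 ▸ hm ⟨le_rfl, hb.le⟩ hy hy.1, h1 ▸ hm hy ⟨hb.le, le_rfl⟩ hy.2⟩

/-- All utilities vanish at the first breakpoint, so this passes to the reduced matrix `P` without
loss. -/
lemma Fin.sum_eq_sum_succ_of_zero {n : ℕ} (f : Fin n → ℝ) (h0 : ∀ h : 0 < n, f ⟨0, h⟩ = 0) :
    ∑ j, f j = ∑ j : Fin (n - 1), f ⟨j.1 + 1, by have := j.2; omega⟩ := by
  cases n with
  | zero => simp
  | succ n =>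
    rw [Fin.sum_univ_succ, show f 0 = 0 from h0 n.succ_pos, zero_add]
    rfl

namespace Queries

variable {b : ℝ} {K : ℕ} (D : Queries b K)

lemma mem_supportSet_left : (0 : ℝ) ∈ D.supportSet := by simp [supportSet]

lemma mem_supportSet_right : b ∈ D.supportSet := by simp [supportSet]

lemma support_W_subset (k : Fin K) : (D.W k).finite.toFinset ⊆ D.supportSet := fun _ hy =>
  Finset.mem_union_right _ (Finset.mem_biUnion.2 ⟨k, Finset.mem_univ _, Finset.mem_union_left _ hy⟩)

lemma support_Y_subset (k : Fin K) : (D.Y k).finite.toFinset ⊆ D.supportSet := fun _ hy =>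
  Finset.mem_union_right _
    (Finset.mem_biUnion.2 ⟨k, Finset.mem_univ _, Finset.mem_union_right _ hy⟩)

lemma mem_Icc_of_mem_supportSet (hb : 0 < b) {y : ℝ} (hy : y ∈ D.supportSet) :
    y ∈ Set.Icc 0 b := by
  simp only [supportSet, Finset.mem_union, Finset.mem_insert, Finset.mem_singleton,
    Finset.mem_biUnion, Finset.mem_univ, true_and] at hy
  rcases hy with (rfl | rfl) | ⟨k, hy | hy⟩
  · exact ⟨le_rfl, hb.le⟩
  · exact ⟨hb.le, le_rfl⟩
  · exact (D.W k).mem_Icc (by simpa using hy)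
  · exact (D.Y k).mem_Icc (by simpa using hy)

lemma two_le_N (hb : 0 < b) : 2 ≤ D.N := by
  rw [← Finset.card_pair hb.ne]
  exact Finset.card_le_card Finset.subset_union_left

lemma y_mem (j : Fin D.N) : D.y j ∈ D.supportSet := Finset.orderEmbOfFin_mem _ _ _

lemma exists_y_eq {a : ℝ} (ha : a ∈ D.supportSet) : ∃ j, D.y j = a := by
  have h := Finset.range_orderEmbOfFin D.supportSet rfl
  exact (h.symm ▸ ha : a ∈ Set.range (D.supportSet.orderEmbOfFin rfl))

lemma y_injective : Function.Injective D.y := (D.supportSet.orderEmbOfFin rfl).injective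

lemma y_zero (hb : 0 < b) (h : 0 < D.N) : D.y ⟨0, h⟩ = 0 := by
  obtain ⟨j, hj⟩ := D.exists_y_eq D.mem_supportSet_left
  refine le_antisymm ?_ (D.mem_Icc_of_mem_supportSet hb (D.y_mem _)).1
  rw [← hj]
  exact (D.supportSet.orderEmbOfFin rfl).monotone (Nat.zero_le _)

lemma sum_y (f : ℝ → ℝ) : ∑ j, f (D.y j) = ∑ a ∈ D.supportSet, f a := by
  refine Finset.sum_bij (fun j _ => D.y j) (fun j _ => D.y_mem j) (fun _ _ _ _ h => D.y_injective h)
    (fun a ha => ?_) (fun _ _ => rfl)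
  obtain ⟨j, hj⟩ := D.exists_y_eq ha
  exact ⟨j, Finset.mem_univ _, hj⟩

lemma utilityGap_eq_sum (u : ℝ → ℝ) (k : Fin K) :
    D.utilityGap u k = ∑ j, D.p k j * u (D.y j) := by
  rw [utilityGap, (D.W k).expect_eq_sum (D.support_W_subset k),
    (D.Y k).expect_eq_sum (D.support_Y_subset k), ← Finset.sum_sub_distrib]
  simp_rw [← sub_mul]
  exact (D.sum_y fun a => ((D.W k).prob a - (D.Y k).prob a) * u a).symm

lemma abs_utilityGap_le {u : ℝ → ℝ} (hb : 0 < b) {L : ℝ≥0} (hu : u ∈ vnmUtilities b L)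
    (k : Fin K) : |D.utilityGap u k| ≤ 1 := by
  have h1 := (D.W k).expect_mem_Icc fun _ hy => mem_Icc_of_mem_vnmUtilities hb hu hy
  have h2 := (D.Y k).expect_mem_Icc fun _ hy => mem_Icc_of_mem_vnmUtilities hb hu hy
  rw [utilityGap, abs_le]
  constructor <;> linarith [h1.1, h1.2, h2.1, h2.2]

lemma posSemidef_infoMatrix : D.infoMatrix.PosSemidef :=
  (Matrix.posSemidef_conjTranspose_mul_self D.P).smul (by positivity)

lemma dotProduct_infoMatrix (x : Fin (D.N - 1) → ℝ) :
    x ⬝ᵥ D.infoMatrix.mulVec x = (∑ k, (D.P.mulVec x k) ^ 2) / K := by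
  rw [infoMatrix, Matrix.smul_mulVec, dotProduct_smul, ← Matrix.mulVec_mulVec,
    Matrix.dotProduct_mulVec, Matrix.vecMul_transpose]
  simp [dotProduct, pow_two]
  ring

end Queries

/-! ### Smallest eigenvalue and projection onto the column space. -/

lemma spectrum_nonneg_of_posSemidef {n : ℕ} {A : Matrix (Fin n) (Fin n) ℝ} (hA : A.PosSemidef) :
    ∀ x ∈ spectrum ℝ A, 0 ≤ x := fun _ hx =>
  (Matrix.posSemidef_iff_isHermitian_and_spectrum_nonneg.1 hA).2 hx

/-- The smallest eigenvalue bounds the quadratic form from below. -/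
lemma mul_sum_sq_le_of_le_lambdaMin {n : ℕ} {A : Matrix (Fin n) (Fin n) ℝ} (hA : A.PosSemidef)
    {lam : ℝ} (h : lam ≤ lambdaMin A) (x : Fin n → ℝ) :
    lam * ∑ j, x j ^ 2 ≤ x ⬝ᵥ A.mulVec x := by
  -- Subtracting `lam` times the identity shifts the spectrum, which stays nonnegative.
  have hB : (A - algebraMap ℝ _ lam).PosSemidef := by
    rw [Matrix.posSemidef_iff_isHermitian_and_spectrum_nonneg]
    refine ⟨hA.1.sub ?_, ?_⟩
    · rw [Algebra.algebraMap_eq_smul_one]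
      simp [Matrix.IsHermitian]
    · intro y hy
      rw [← spectrum.sub_singleton_eq] at hy
      obtain ⟨z, hz, w, rfl, rfl⟩ := Set.mem_sub.1 hy
      have : lambdaMin A ≤ z := csInf_le ⟨0, spectrum_nonneg_of_posSemidef hA⟩ hz
      show 0 ≤ z - w
      linarith
  have := hB.dotProduct_mulVec_nonneg x
  rw [Matrix.sub_mulVec, dotProduct_sub, Algebra.algebraMap_eq_smul_one, Matrix.smul_mulVec,
    Matrix.one_mulVec, dotProduct_smul] at this
  have h2 : x ⬝ᵥ x = ∑ j, x j ^ 2 := by simp [dotProduct, pow_two]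
  simp only [star_trivial, smul_eq_mul, h2] at this
  linarith

/-- An orthonormal basis of the column space, with the resulting Cauchy-Schwarz bound. -/
lemma Matrix.exists_orthonormal_sq_sum_mulVec_le {K n : ℕ} (P : Matrix (Fin K) (Fin n) ℝ) :
    ∃ d ≤ n, ∃ q : Fin d → EuclideanSpace ℝ (Fin K), Orthonormal ℝ q ∧
      ∀ (x : Fin n → ℝ) (v : Fin K → ℝ), (∑ k, v k * P.mulVec x k) ^ 2
        ≤ (∑ i, (∑ k, q i k * v k) ^ 2) * ∑ k, P.mulVec x k ^ 2 := by
  set R := LinearMap.range (Matrix.toEuclideanLin P)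
  let β := stdOrthonormalBasis ℝ R
  refine ⟨Module.finrank ℝ R, ?_, fun i => (β i : EuclideanSpace ℝ (Fin K)),
    β.orthonormal.comp_linearIsometry R.subtypeₗᵢ, fun x v => ?_⟩
  · exact (LinearMap.finrank_range_le _).trans (by simp)
  · set d : R := ⟨Matrix.toEuclideanLin P (WithLp.toLp 2 x), LinearMap.mem_range_self _ _⟩ with hd
    have hdk : ∀ k, (d : EuclideanSpace ℝ (Fin K)) k = P.mulVec x k := fun k => rfl
    have hnorm : ∑ i, (inner ℝ (β i) d) ^ 2 = ∑ k, P.mulVec x k ^ 2 := by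
      have h1 := β.sum_sq_norm_inner_right d
      simp only [Real.norm_eq_abs, sq_abs] at h1
      rw [h1, Submodule.coe_norm, EuclideanSpace.norm_sq_eq]
      simp [hdk]
    have hsum : ∑ k, v k * P.mulVec x k
        = ∑ i, (∑ k, (β i : EuclideanSpace ℝ (Fin K)) k * v k) * inner ℝ (β i) d := by
      have h2 : ∀ k, P.mulVec x k
          = ∑ i, inner ℝ (β i) d * (β i : EuclideanSpace ℝ (Fin K)) k := by
        intro k
        have h3 := congrArg (fun z : R => (z : EuclideanSpace ℝ (Fin K)) k) (β.sum_repr' d)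
        simp only [Submodule.coe_sum, Submodule.coe_smul] at h3
        rw [← hdk, ← h3]
        simp
      simp_rw [h2, Finset.mul_sum, Finset.sum_mul]
      rw [Finset.sum_comm]
      exact Finset.sum_congr rfl fun i _ => Finset.sum_congr rfl fun k _ => by ring
    rw [hsum, ← hnorm]
    exact Finset.sum_mul_sq_le_sq_mul_sq _ _ _

/-! ### The estimation error on the event that the projected residuals are small -/

lemma log_one_div_one_add_exp (z t : ℝ) (hz : z = 1 ∨ z = -1) :
    Real.log (1 / (1 + Real.exp (-z * t)))
      = (if z = 1 then 1 else 0) * t - Real.log (1 + Real.exp t) := by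
  rw [one_div, Real.log_inv]
  rcases hz with rfl | rfl
  · have : 1 + Real.exp t = Real.exp t * (1 + Real.exp (-1 * t)) := by
      rw [mul_add, ← Real.exp_add]; simp [add_comm]
    rw [this, Real.log_mul (by positivity) (by positivity), Real.log_exp]
    simp
  · norm_num

/-- In terms of the inverse scale the parameter range is a compact interval, with `σ = ∞` at its end
`0`. -/
lemma toReal_inv_mem_Icc {cbar : ℝ} (hc : 0 < cbar) {σ : ℝ≥0∞}
    (hσ : ENNReal.ofReal (1 / cbar) ≤ σ) : (σ⁻¹).toReal ∈ Set.Icc 0 cbar := by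
  refine ⟨ENNReal.toReal_nonneg, ?_⟩
  refine ENNReal.toReal_le_of_le_ofReal hc.le ?_
  rw [ENNReal.inv_le_iff_inv_le, ← ENNReal.ofReal_inv_of_pos hc, ← one_div]
  exact hσ

lemma omegaConst_pos (c : ℝ) : 0 < omegaConst c := by unfold omegaConst; positivity

lemma Queries.logLik_eq {b : ℝ} {K : ℕ} (D : Queries b K) {z : Fin K → ℝ}
    (hz : ∀ k, z k = 1 ∨ z k = -1) (u : ℝ → ℝ) (σ : ℝ≥0∞) :
    D.logLik z u σ = ∑ k, ((if z k = 1 then 1 else 0) * (D.utilityGap u k * (σ⁻¹).toReal)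
      - Real.log (1 + Real.exp (D.utilityGap u k * (σ⁻¹).toReal))) :=
  Finset.sum_congr rfl fun k _ => by rw [mul_assoc, log_one_div_one_add_exp _ _ (hz k)]

namespace DecisionMaker

variable {cbar : ℝ} {K : ℕ} (M : DecisionMaker cbar) (D : Queries M.b K)

lemma σ_pos (hc : 0 < cbar) : 0 < M.σ := (one_div_pos.2 hc).trans_le M.le_σ

lemma one_div_σ_le (hc : 0 < cbar) : 1 / M.σ ≤ cbar := by
  rw [one_div_le (M.σ_pos hc) hc]; exact M.le_σ

/-- The centred choice indicator, i.e. the score of query `k` at the truth. -/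
def residual (z : Fin K → ℝ) (k : Fin K) : ℝ :=
  (if z k = 1 then 1 else 0) - Real.sigmoid (D.utilityGap M.u k / M.σ)

/-- The estimation error without its entry at the first breakpoint. -/
def reducedError (u : ℝ → ℝ) (σ : ℝ≥0∞) (j : Fin (D.N - 1)) : ℝ :=
  M.error D u σ ⟨j.1 + 1, by have := j.2; omega⟩

lemma error_zero {u : ℝ → ℝ} (hu : u 0 = 0) (σ : ℝ≥0∞) (h : 0 < D.N) :
    M.error D u σ ⟨0, h⟩ = 0 := by
  simp [error, D.y_zero M.b_pos h, hu, M.u_mem.2.2.2.1]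

lemma errorTwo_sq {u : ℝ → ℝ} (hu : u 0 = 0) (σ : ℝ≥0∞) :
    M.errorTwo D u σ ^ 2 = ∑ j, M.reducedError D u σ j ^ 2 := by
  rw [errorTwo, EuclideanSpace.norm_sq_eq]
  simp only [Real.norm_eq_abs, sq_abs]
  exact Fin.sum_eq_sum_succ_of_zero (fun j => M.error D u σ j ^ 2)
    fun h => by simp [M.error_zero D hu σ h]

lemma mulVec_reducedError {u : ℝ → ℝ} (hu : u 0 = 0) (σ : ℝ≥0∞) (k : Fin K) :
    D.P.mulVec (M.reducedError D u σ) k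
      = D.utilityGap u k * (σ⁻¹).toReal - D.utilityGap M.u k / M.σ := by
  have h := Fin.sum_eq_sum_succ_of_zero (fun j => D.p k j * M.error D u σ j)
    fun h => by simp [M.error_zero D hu σ h]
  refine h.symm.trans ?_
  rw [D.utilityGap_eq_sum, D.utilityGap_eq_sum, Finset.sum_mul, Finset.sum_div,
    ← Finset.sum_sub_distrib]
  exact Finset.sum_congr rfl fun j _ => by simp only [error]; ring

lemma errorSup_le_errorTwo (u : ℝ → ℝ) (σ : ℝ≥0∞) : M.errorSup D u σ ≤ M.errorTwo D u σ := by
  rw [errorSup, errorTwo, pi_norm_le_iff_of_nonneg (norm_nonneg _)]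
  exact fun j => PiLp.norm_apply_le (WithLp.toLp 2 (M.error D u σ)) j

/-- The basic inequality of maximum likelihood estimation. -/
lemma sum_sq_mulVec_reducedError_le (hc : 0 < cbar) {z : Fin K → ℝ}
    (hz : ∀ k, z k = 1 ∨ z k = -1) {u : ℝ → ℝ} {σ : ℝ≥0∞} (h : D.IsMLE M.L cbar z u σ) :
    omegaConst cbar / 2 * ∑ k, D.P.mulVec (M.reducedError D u σ) k ^ 2
      ≤ ∑ k, M.residual D z k * D.P.mulVec (M.reducedError D u σ) k := by
  obtain ⟨hu, hσ, hmax⟩ := h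
  have hs := toReal_inv_mem_Icc hc hσ
  have hσp := M.σ_pos hc
  have hle := hmax M.u M.u_mem (ENNReal.ofReal M.σ) (ENNReal.ofReal_le_ofReal M.le_σ)
  rw [D.logLik_eq hz, D.logLik_eq hz, ENNReal.toReal_inv, ENNReal.toReal_ofReal hσp.le] at hle
  rw [Finset.mul_sum, ← sub_nonneg, ← Finset.sum_sub_distrib]
  rw [← sub_nonneg, ← Finset.sum_sub_distrib] at hle
  refine hle.trans (Finset.sum_le_sum fun k _ => ?_)
  rw [M.mulVec_reducedError D hu.2.2.2.1, div_eq_mul_inv (D.utilityGap M.u k)]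
  have hmem : ∀ {w : ℝ → ℝ}, w ∈ vnmUtilities M.b M.L → ∀ {r : ℝ}, 0 ≤ r → r ≤ cbar →
      D.utilityGap w k * r ∈ Set.Icc (-cbar) cbar := by
    intro w hw r h0 h1
    rw [Set.mem_Icc, ← abs_le, abs_mul, abs_of_nonneg h0]
    calc _ ≤ 1 * r := mul_le_mul_of_nonneg_right (D.abs_utilityGap_le M.b_pos hw k) h0
      _ ≤ cbar := by linarith
  -- Expanding at the true value makes the linear coefficient `B_k - sigmoid t*_k`, the residual.
  have hsp := softplus_quadratic_lower_bound
    (hmem M.u_mem (inv_nonneg.2 hσp.le) (one_div M.σ ▸ M.one_div_σ_le hc)) (hmem hu hs.1 hs.2)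
  rw [residual, div_eq_mul_inv]
  linarith

/-- The `ℓ₂` error in terms of the projection of the residuals onto the column space. -/
lemma errorTwo_le_of_quadratic_le (hc : 0 < cbar) (hK : 0 < K) {lam : ℝ} (hlam : 0 < lam)
    (hmin : lam ≤ lambdaMin D.infoMatrix) {z : Fin K → ℝ} (hz : ∀ k, z k = 1 ∨ z k = -1)
    {u : ℝ → ℝ} {σ : ℝ≥0∞} (h : D.IsMLE M.L cbar z u σ) {s : ℝ}
    (hs : (∑ k, M.residual D z k * D.P.mulVec (M.reducedError D u σ) k) ^ 2
      ≤ s * ∑ k, D.P.mulVec (M.reducedError D u σ) k ^ 2) (h0 : 0 ≤ s) :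
    M.errorTwo D u σ ≤ 2 / √lam * √(s / (omegaConst cbar ^ 2 * K)) := by
  have hbasic := M.sum_sq_mulVec_reducedError_le D hc hz h
  have hray := mul_sum_sq_le_of_le_lambdaMin D.posSemidef_infoMatrix hmin (M.reducedError D u σ)
  rw [D.dotProduct_infoMatrix, ← M.errorTwo_sq D h.1.2.2.2.1] at hray
  have hKr : (0 : ℝ) < K := Nat.cast_pos.2 hK
  rw [le_div_iff₀ hKr] at hray
  set Q := ∑ k, D.P.mulVec (M.reducedError D u σ) k ^ 2
  have hQ : 0 ≤ Q := Finset.sum_nonneg fun _ _ => sq_nonneg _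
  have hω := omegaConst_pos cbar
  set w := omegaConst cbar
  -- Square the basic inequality, apply `hs` and cancel one factor `Q`, which may vanish.
  have hQs : w ^ 2 * Q ≤ 4 * s := by
    rcases hQ.eq_or_lt with h1 | h1
    · rw [← h1]; linarith
    · have h2 : (w / 2 * Q) ^ 2 ≤ s * Q := (pow_le_pow_left₀ (by positivity) hbasic 2).trans hs
      have h3 : (w ^ 2 * Q) * Q ≤ (4 * s) * Q := by linarith
      exact le_of_mul_le_mul_right h3 h1
  have hfin : M.errorTwo D u σ ^ 2 ≤ (2 / √lam * √(s / (w ^ 2 * K))) ^ 2 := by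
    rw [mul_pow, div_pow, Real.sq_sqrt hlam.le, Real.sq_sqrt (by positivity), div_mul_div_comm,
      le_div_iff₀ (by positivity)]
    calc M.errorTwo D u σ ^ 2 * (lam * (w ^ 2 * K))
        = w ^ 2 * (lam * M.errorTwo D u σ ^ 2 * K) := by ring
      _ ≤ w ^ 2 * Q := mul_le_mul_of_nonneg_left hray (by positivity)
      _ ≤ _ := by linarith
  exact le_of_sq_le_sq hfin (by positivity)

/-- The error entries lie in `[-cbar, cbar]`. -/
lemma errorTwo_le (hc : 0 < cbar) {u : ℝ → ℝ} (hu : u ∈ vnmUtilities M.b M.L) {σ : ℝ≥0∞}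
    (hσ : ENNReal.ofReal (1 / cbar) ≤ σ) :
    M.errorTwo D u σ ≤ cbar * √((D.N : ℝ) - 1) := by
  have hN : (1 : ℝ) ≤ D.N := by exact_mod_cast (one_le_two.trans (D.two_le_N M.b_pos))
  have hs := toReal_inv_mem_Icc hc hσ
  have hσp := M.σ_pos hc
  have hentry : ∀ j, M.reducedError D u σ j ^ 2 ≤ cbar ^ 2 := by
    intro j
    have hmem := D.mem_Icc_of_mem_supportSet M.b_pos (D.y_mem ⟨j.1 + 1, by have := j.2; omega⟩)
    have h1 := mem_Icc_of_mem_vnmUtilities M.b_pos hu hmem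
    have h2 := mem_Icc_of_mem_vnmUtilities M.b_pos M.u_mem hmem
    have h3 := M.one_div_σ_le hc
    rw [reducedError, error, div_eq_mul_one_div (M.u _)]
    apply sq_le_sq'
    · nlinarith [mul_nonneg h1.1 hs.1, mul_le_mul h2.2 h3 (one_div_pos.2 hσp).le zero_le_one]
    · nlinarith [mul_le_mul h1.2 hs.2 hs.1 zero_le_one, mul_nonneg h2.1 (one_div_pos.2 hσp).le]
  have hsq : M.errorTwo D u σ ^ 2 ≤ (cbar * √((D.N : ℝ) - 1)) ^ 2 := by
    rw [M.errorTwo_sq D hu.2.2.2.1, mul_pow, Real.sq_sqrt (by linarith)]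
    refine (Finset.sum_le_card_nsmul _ _ _ fun j _ => hentry j).trans_eq ?_
    rw [Finset.card_univ, Fintype.card_fin, nsmul_eq_mul, Nat.cast_sub (by exact_mod_cast hN)]
    push_cast
    ring
  exact le_of_sq_le_sq hsq (by positivity)

/-! ### The distribution of the choices -/

variable {M D} {Ω : Type*} [MeasurableSpace Ω] {μ : Measure Ω} [IsProbabilityMeasure μ]
  {Z : Fin K → Ω → ℝ}

omit [IsProbabilityMeasure μ] in
lemma IsChoice.eq_one_or (h : M.IsChoice D μ Z) (ω : Ω) (k : Fin K) :
    Z k ω = 1 ∨ Z k ω = -1 := by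
  obtain ⟨ε, -, -, -, hZ⟩ := h
  rw [hZ]
  split_ifs <;> simp

/-- The choice in query `k` depends only on its own pair of errors, which gives independence; its
mean is the logistic probability, and Hoeffding's lemma for range one gives `1/4`. -/
lemma IsChoice.residual_properties (hc : 0 < cbar) (h : M.IsChoice D μ Z) :
    (∀ k, Measurable fun ω => M.residual D (fun k => Z k ω) k) ∧
    iIndepFun (fun k ω => M.residual D (fun k => Z k ω) k) μ ∧
    ∀ k, HasSubgaussianMGF (fun ω => M.residual D (fun k => Z k ω) k) (1 / 4) μ := by
  obtain ⟨ε, hm, hlaw, hind, hZ⟩ := h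
  set g := fun k => D.utilityGap M.u k with hg
  let S : Fin K → Set (Fin 2 → ℝ) := fun k => {x | x 1 ≤ x 0 + g k}
  have hS : ∀ k, MeasurableSet (S k) := fun k => measurableSet_le (by fun_prop) (by fun_prop)
  have hZ1 : ∀ k ω, Z k ω = 1 ↔ (fun i => ε (k, i) ω) ∈ S k := by
    intro k ω
    rw [hZ]
    have : ((D.Y k).expect M.u + ε (k, 1) ω ≤ (D.W k).expect M.u + ε (k, 0) ω)
        ↔ (fun i => ε (k, i) ω) ∈ S k := by
      show _ ↔ ε (k, 1) ω ≤ ε (k, 0) ω + ((D.W k).expect M.u - (D.Y k).expect M.u)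
      constructor <;> intro h <;> linarith
    split_ifs with h
    · simpa using this.1 h
    · rw [← this]; norm_num; linarith
  have hB : ∀ k ω, (if Z k ω = 1 then (1 : ℝ) else 0)
      = (S k).indicator (fun _ => (1 : ℝ)) (fun i => ε (k, i) ω) := by
    intro k ω
    rw [Set.indicator_apply]
    exact if_congr (hZ1 k ω) rfl rfl
  have hres : ∀ k ω, M.residual D (fun k => Z k ω) k
      = (S k).indicator (fun _ => (1 : ℝ)) (fun i => ε (k, i) ω)
        - Real.sigmoid (g k / M.σ) := fun k ω => by rw [residual, hB]
  have hBm : ∀ k, Measurable fun x => (S k).indicator (fun _ => (1 : ℝ)) x :=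
    fun k => measurable_const.indicator (hS k)
  have hεm : ∀ k, Measurable fun ω i => ε (k, i) ω := fun k => by fun_prop
  have hmean : ∀ k, ∫ ω, (S k).indicator (fun _ => (1 : ℝ)) (fun i => ε (k, i) ω) ∂μ
      = Real.sigmoid (g k / M.σ) := by
    intro k
    have hprob : IsProbabilityMeasure (gumbel M.σ) :=
      hlaw (k, 0) ▸ Measure.isProbabilityMeasure_map (hm _).aemeasurable
    have hpair : μ.map (fun ω => (ε (k, 0) ω, ε (k, 1) ω))
        = (gumbel M.σ).prod (gumbel M.σ) := by
      have hi : IndepFun (ε (k, 0)) (ε (k, 1)) μ := hind.indepFun (by simp)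
      rw [(indepFun_iff_map_prod_eq_prod_map_map (hm _).aemeasurable (hm _).aemeasurable).1 hi,
        hlaw, hlaw]
    have hμ : μ ((fun ω i => ε (k, i) ω) ⁻¹' S k) = ENNReal.ofReal (Real.sigmoid (g k / M.σ)) := by
      rw [← gumbel_prod_le (M.σ_pos hc), ← hpair, Measure.map_apply (by fun_prop)
        (measurableSet_le measurable_snd (measurable_fst.add_const _))]
      rfl
    have : (fun ω => (S k).indicator (fun _ => (1 : ℝ)) (fun i => ε (k, i) ω))
        = ((fun ω i => ε (k, i) ω) ⁻¹' S k).indicator fun _ => (1 : ℝ) := rfl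
    rw [this, integral_indicator_const _ (hεm k (hS k)), measureReal_def, hμ,
      ENNReal.toReal_ofReal (Real.sigmoid_nonneg _), smul_eq_mul, mul_one]
  refine ⟨fun k => ?_, ?_, fun k => ?_⟩
  · simp_rw [hres]
    exact ((hBm k).comp (hεm k)).sub_const _
  · simp_rw [hres]
    exact (iIndepFun_curry hm hind).comp
      (fun k x => (S k).indicator (fun _ => (1 : ℝ)) x - Real.sigmoid (g k / M.σ))
      (fun k => (hBm k).sub_const _)
  · simp_rw [hres, ← hmean k]
    have hsub := hasSubgaussianMGF_of_mem_Icc (μ := μ) (a := 0) (b := 1)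
      (((hBm k).comp (hεm k)).aemeasurable) (ae_of_all _ fun ω => by
        simp only [Function.comp, Set.indicator_apply]
        split_ifs <;> simp)
    convert hsub using 1
    simp
    norm_num

/-- The finite-sample bound under a lower bound on the smallest eigenvalue. -/
lemma IsChoice.measure_errorEvent_ge (hc : 0 < cbar) (hK : 0 < K) {lam : ℝ} (hlam : 0 < lam)
    (hmin : lam ≤ lambdaMin D.infoMatrix) (h : M.IsChoice D μ Z) {δ : ℝ} (h0 : 0 < δ) :
    ENNReal.ofReal (1 - δ) ≤ μ (M.errorEvent D Z (boundFull cbar lam δ D.N K)) := by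
  obtain ⟨hm, hind, hsub⟩ := h.residual_properties hc
  obtain ⟨d, hd, q, hq, hP⟩ := Matrix.exists_orthonormal_sq_sum_mulVec_le D.P
  have hN := D.two_le_N M.b_pos
  have htail := measure_quadratic_gt_le hm hind hsub hq (-Real.log δ)
  rw [neg_neg, Real.exp_log h0, Fintype.card_fin] at htail
  set S : Ω → ℝ := fun ω => ∑ i, (∑ k, q i k * M.residual D (fun k => Z k ω) k) ^ 2 with hSdef
  have hSm : Measurable S := by fun_prop
  have hset : MeasurableSet {ω | (d : ℝ) + 2 * -Real.log δ < S ω} :=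
    measurableSet_lt measurable_const hSm
  have hcompl : ENNReal.ofReal (1 - δ) ≤ μ {ω | (d : ℝ) + 2 * -Real.log δ < S ω}ᶜ := by
    rw [prob_compl_eq_one_sub hset, ENNReal.ofReal_sub _ h0.le, ENNReal.ofReal_one]
    exact tsub_le_tsub_left htail _
  -- `errorEvent` contains this measurable event, so its own measurability is not needed.
  refine hcompl.trans (measure_mono fun ω hω u σ hmle => ⟨M.errorSup_le_errorTwo D u σ, ?_⟩)
  have hω : S ω ≤ d + 2 * -Real.log δ := not_lt.1 hω
  refine (M.errorTwo_le_of_quadratic_le D hc hK hlam hmin (fun k => h.eq_one_or ω k) hmle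
    (hP _ _) (Finset.sum_nonneg fun _ _ => sq_nonneg _)).trans ?_
  rw [boundFull, varTerm]
  refine mul_le_mul_of_nonneg_left (Real.sqrt_le_sqrt ?_) (by positivity)
  have hω2 : 0 < omegaConst cbar ^ 2 * K :=
    mul_pos (pow_pos (omegaConst_pos _) 2) (Nat.cast_pos.2 hK)
  refine div_le_div_of_nonneg_right ?_ hω2.le
  have hdr : (d : ℝ) ≤ (D.N : ℝ) - 1 := by
    have : d + 1 ≤ D.N := by omega
    have : (d : ℝ) + 1 ≤ D.N := by exact_mod_cast this
    linarith
  have := Real.sqrt_nonneg (-((D.N : ℝ) - 1) * Real.log δ)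
  linarith

end DecisionMaker

/-! ### The order of the bounds -/

lemma varTerm_nonneg (cbar : ℝ) {δ : ℝ} (h0 : 0 < δ) (h1 : δ < 1) {N : ℕ} (hN : 1 ≤ N) (K : ℕ) :
    0 ≤ varTerm cbar δ N K := by
  have hl := Real.log_neg h0 h1
  have hN' : (1 : ℝ) ≤ N := by exact_mod_cast hN
  have := Real.sqrt_nonneg (-((N : ℝ) - 1) * Real.log δ)
  unfold varTerm
  exact div_nonneg (by linarith) (by positivity)

lemma varTerm_le (cbar : ℝ) {δ : ℝ} (h0 : 0 < δ) (h1 : δ < 1) {N : ℕ} (hN : 1 ≤ N) (K : ℕ) :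
    varTerm cbar δ N K ≤ (2 - 3 * Real.log δ) / omegaConst cbar ^ 2 * (N / K) := by
  have hl := Real.log_neg h0 h1
  have hN' : (1 : ℝ) ≤ N := by exact_mod_cast hN
  -- AM-GM for `N - 1` and `-log δ`.
  have hsq : 2 * √(-((N : ℝ) - 1) * Real.log δ) ≤ (N - 1) - Real.log δ := by
    have : √(-((N : ℝ) - 1) * Real.log δ) ≤ ((N - 1) - Real.log δ) / 2 := by
      rw [Real.sqrt_le_left (by linarith)]
      nlinarith [sq_nonneg ((N : ℝ) - 1 + Real.log δ)]
    linarith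
  rw [varTerm, div_mul_div_comm]
  refine div_le_div_of_nonneg_right ?_ (by positivity)
  nlinarith

lemma sqrt_varTerm_le (cbar : ℝ) {δ : ℝ} (h0 : 0 < δ) (h1 : δ < 1) {N : ℕ} (hN : 1 ≤ N) (K : ℕ) :
    √(varTerm cbar δ N K) ≤ √((2 - 3 * Real.log δ) / omegaConst cbar ^ 2) * √((N : ℝ) / K) := by
  have hl := Real.log_neg h0 h1
  rw [← Real.sqrt_mul (div_nonneg (by linarith) (sq_nonneg _))]
  exact Real.sqrt_le_sqrt (varTerm_le cbar h0 h1 hN K)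

lemma exists_boundFull_le (cbar : ℝ) {lam : ℝ} (hlam : 0 < lam) {δ : ℝ} (h0 : 0 < δ)
    (h1 : δ < 1) :
    ∃ C : ℝ, 0 < C ∧ ∀ N K : ℕ, 2 ≤ N → 0 < K →
      boundFull cbar lam δ N K ≤ C * √((N : ℝ) / K) := by
  have hl := Real.log_neg h0 h1
  have hω := omegaConst_pos cbar
  refine ⟨2 / √lam * √((2 - 3 * Real.log δ) / omegaConst cbar ^ 2), ?_, fun N K hN _ => ?_⟩
  · have : 0 < (2 - 3 * Real.log δ) / omegaConst cbar ^ 2 := div_pos (by linarith) (by positivity)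
    positivity
  · rw [mul_assoc]
    exact mul_le_mul_of_nonneg_left (sqrt_varTerm_le cbar h0 h1 (by omega) K) (by positivity)

lemma sqrt_add_le_sqrt_add_sqrt {x y : ℝ} (hx : 0 ≤ x) (hy : 0 ≤ y) : √(x + y) ≤ √x + √y := by
  rw [Real.sqrt_le_left (by positivity), add_sq, Real.sq_sqrt hx, Real.sq_sqrt hy]
  linarith [mul_nonneg (Real.sqrt_nonneg x) (Real.sqrt_nonneg y)]

lemma boundDeficient_le {cbar : ℝ} (hc : 0 < cbar) {lam : ℝ} (hlam : 0 < lam) {δ : ℝ}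
    (h0 : 0 < δ) (h1 : δ < 1) {N : ℕ} (hN : 1 ≤ N) (K : ℕ) :
    boundDeficient cbar lam δ N K ≤ boundFull cbar lam δ N K + 2 * (cbar * √(N : ℝ)) := by
  have hsq : √(lam * (cbar * √((N : ℝ) - 1)) ^ 2) = √lam * (cbar * √((N : ℝ) - 1)) := by
    rw [Real.sqrt_mul hlam.le, Real.sqrt_sq (by positivity)]
  have hs : 0 < √lam := Real.sqrt_pos.2 hlam
  calc boundDeficient cbar lam δ N K
      ≤ 2 / √lam * (√(varTerm cbar δ N K) + √(lam * (cbar * √((N : ℝ) - 1)) ^ 2)) :=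
        mul_le_mul_of_nonneg_left
          (sqrt_add_le_sqrt_add_sqrt (varTerm_nonneg cbar h0 h1 hN K) (by positivity))
          (by positivity)
    _ = boundFull cbar lam δ N K + 2 * (cbar * √((N : ℝ) - 1)) := by
        rw [hsq, boundFull]
        field_simp
    _ ≤ _ := by gcongr; linarith

/-- The regularisation term alone contributes `2 * (cbar * √(N - 1))`, since `√lam` cancels. -/
lemma le_boundDeficient {cbar : ℝ} (hc : 0 < cbar) {lam : ℝ} (hlam : 0 < lam) {δ : ℝ}
    (h0 : 0 < δ) (h1 : δ < 1) {N : ℕ} (hN : 1 ≤ N) (K : ℕ) :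
    cbar * √((N : ℝ) - 1) ≤ boundDeficient cbar lam δ N K := by
  have hs : 0 < √lam := Real.sqrt_pos.2 hlam
  have hsq : √lam * (cbar * √((N : ℝ) - 1))
      ≤ √(varTerm cbar δ N K + lam * (cbar * √((N : ℝ) - 1)) ^ 2) := by
    rw [← Real.sqrt_sq (by positivity : 0 ≤ cbar * √((N : ℝ) - 1)), ← Real.sqrt_mul hlam.le]
    refine Real.sqrt_le_sqrt ?_
    rw [Real.sqrt_sq (by positivity)]
    linarith [varTerm_nonneg cbar h0 h1 hN K]
  calc cbar * √((N : ℝ) - 1) ≤ 2 * (cbar * √((N : ℝ) - 1)) := by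
        linarith [(by positivity : 0 ≤ cbar * √((N : ℝ) - 1))]
    _ = 2 / √lam * (√lam * (cbar * √((N : ℝ) - 1))) := by field_simp
    _ ≤ _ := mul_le_mul_of_nonneg_left hsq (by positivity)

namespace DecisionMaker

variable {cbar : ℝ} (M : DecisionMaker cbar)

lemma errorEvent_mono {K : ℕ} (D : Queries M.b K) {Ω : Type*} (Z : Fin K → Ω → ℝ) {r s : ℝ}
    (h : r ≤ s) : M.errorEvent D Z r ⊆ M.errorEvent D Z s :=
  fun _ hω u σ hmle => ⟨(hω u σ hmle).1, (hω u σ hmle).2.trans h⟩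

/-- Consistency when the number of breakpoints is negligible against the number of queries. -/
lemma tendsto_measure_errorEvent (hc : 0 < cbar) {lam : ℝ} (hlam : 0 < lam)
    {K : ℕ → ℕ} {D : ∀ m, Queries M.b (K m)} (hK : Tendsto K atTop atTop)
    (hmin : ∀ᶠ m in atTop, lam ≤ lambdaMin (D m).infoMatrix)
    (hN : (fun m => ((D m).N : ℝ)) =o[atTop] fun m => (K m : ℝ))
    {Ω : ℕ → Type*} [∀ m, MeasurableSpace (Ω m)] {μ : ∀ m, Measure (Ω m)}
    [∀ m, IsProbabilityMeasure (μ m)] {Z : ∀ m, Fin (K m) → Ω m → ℝ}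
    (hZ : ∀ m, M.IsChoice (D m) (μ m) (Z m)) {η : ℝ} (hη : 0 < η) :
    Tendsto (fun m => μ m (M.errorEvent (D m) (Z m) η)) atTop (𝓝 1) := by
  refine tendsto_order.2 ⟨fun a ha => ?_, fun a ha => Eventually.of_forall fun m =>
    prob_le_one.trans_lt ha⟩
  have ha' : a.toReal < 1 := by
    simpa using (ENNReal.toReal_lt_toReal ha.ne_top ENNReal.one_ne_top).2 ha
  have ha0 : 0 ≤ a.toReal := ENNReal.toReal_nonneg
  -- With this value as `δ`, `1 - δ` lies strictly above `a`.
  have h0 : 0 < (1 - a.toReal) / 2 := by linarith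
  have h1 : (1 - a.toReal) / 2 < 1 := by linarith
  obtain ⟨C, -, hCb⟩ := exists_boundFull_le cbar hlam h0 h1
  have hlim : Tendsto (fun m => C * √(((D m).N : ℝ) / K m)) atTop (𝓝 0) := by
    have := (hN.tendsto_div_nhds_zero.sqrt).const_mul C
    simpa using this
  filter_upwards [hmin, hK.eventually_gt_atTop 0, hlim.eventually_le_const hη] with m hm hKm hle
  have hmain := (hZ m).measure_errorEvent_ge hc hKm hlam hm h0
  have hb := (hCb (D m).N (K m) ((D m).two_le_N M.b_pos) hKm).trans hle
  refine lt_of_lt_of_le ?_ (hmain.trans (measure_mono (M.errorEvent_mono _ _ hb)))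
  exact (ENNReal.lt_ofReal_iff_toReal_lt ha.ne_top).2 (by linarith)

end DecisionMaker

/-! ### A repeated query without consistency -/

lemma linear_mem_vnmUtilities : (fun x : ℝ => x / 2) ∈ vnmUtilities 2 1 := by
  refine ⟨fun x _ y _ h => by simpa using div_le_div_of_nonneg_right h zero_le_two, ?_, ?_,
    by norm_num, by norm_num⟩
  · have h := (LinearMap.mul ℝ ℝ (1 / 2)).concaveOn (convex_Icc (0 : ℝ) 2)
    refine h.congr fun x _ => ?_
    simp [div_eq_inv_mul]
  · refine LipschitzOnWith.of_dist_le_mul fun x _ y _ => ?_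
    rw [Real.dist_eq, Real.dist_eq, ← sub_div, abs_div]
    simp

lemma min_one_mem_vnmUtilities : (fun x : ℝ => min x 1) ∈ vnmUtilities 2 1 := by
  refine ⟨fun x _ y _ h => min_le_min_right 1 h, ?_, ?_, by norm_num, by norm_num⟩
  · exact (concaveOn_id (convex_Icc (0 : ℝ) 2)).inf (concaveOn_const 1 (convex_Icc (0 : ℝ) 2))
  · exact (LipschitzWith.id.min_const 1).lipschitzOnWith

/-- The lottery with a sure outcome. -/
def sureLottery {b : ℝ} (a : ℝ) (ha : a ∈ Set.Icc 0 b) : Lottery b where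
  law := PMF.pure a
  finite := by simp [PMF.support_pure]
  mem_Icc := by simpa [PMF.support_pure] using ha

lemma toFinset_sureLottery {b : ℝ} (a : ℝ) (ha : a ∈ Set.Icc 0 b) :
    (sureLottery a ha).finite.toFinset = {a} := by
  ext x
  rw [Set.Finite.mem_toFinset, Finset.mem_singleton]
  simp [sureLottery, PMF.support_pure]

lemma prob_sureLottery {b : ℝ} (a : ℝ) (ha : a ∈ Set.Icc 0 b) (y : ℝ) :
    (sureLottery a ha).prob y = if y = a then 1 else 0 := by
  rw [Lottery.prob, sureLottery, PMF.pure_apply]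
  split_ifs <;> simp

lemma expect_sureLottery {b : ℝ} (a : ℝ) (ha : a ∈ Set.Icc 0 b) (u : ℝ → ℝ) :
    (sureLottery a ha).expect u = u a := by
  rw [Lottery.expect, toFinset_sureLottery, Finset.sum_singleton, prob_sureLottery]
  simp

lemma lambdaMin_eq_zero_of_mulVec_eq_zero {n : ℕ} {A : Matrix (Fin n) (Fin n) ℝ}
    (hA : A.PosSemidef) {x : Fin n → ℝ} (hx : x ≠ 0) (h : A.mulVec x = 0) : lambdaMin A = 0 := by
  have hmem : (0 : ℝ) ∈ spectrum ℝ A := by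
    rw [spectrum.zero_mem_iff, Matrix.isUnit_iff_isUnit_det, isUnit_iff_ne_zero, not_not]
    exact Matrix.exists_mulVec_eq_zero_iff.1 ⟨x, hx, h⟩
  exact le_antisymm (csInf_le ⟨0, spectrum_nonneg_of_posSemidef hA⟩ hmem)
    (le_csInf ⟨0, hmem⟩ (spectrum_nonneg_of_posSemidef hA))

/-- If the outcome `b` has probability zero in all queries, the information matrix is singular. -/
lemma Queries.lambdaMin_infoMatrix_eq_zero {b : ℝ} (hb : 0 < b) {K : ℕ} (D : Queries b K)
    (h : ∀ k, (D.W k).prob b = (D.Y k).prob b) : lambdaMin D.infoMatrix = 0 := by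
  obtain ⟨⟨j, hj⟩, hjb⟩ := D.exists_y_eq D.mem_supportSet_right
  -- The breakpoint `b` is not the first, so its column survives in `P`; that column is zero.
  have hj0 : j ≠ 0 := by
    rintro rfl
    exact hb.ne ((D.y_zero hb hj).symm.trans hjb)
  obtain ⟨i, rfl⟩ := Nat.exists_eq_succ_of_ne_zero hj0
  have hi : i < D.N - 1 := by omega
  refine lambdaMin_eq_zero_of_mulVec_eq_zero D.posSemidef_infoMatrix
    (x := Pi.single ⟨i, hi⟩ 1) (by simp) ?_
  have hcol : D.P.mulVec (Pi.single ⟨i, hi⟩ 1) = 0 := by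
    ext k
    rw [Matrix.mulVec_single_one]
    show (D.W k).prob (D.y ⟨i + 1, hj⟩) - (D.Y k).prob (D.y ⟨i + 1, hj⟩) = 0
    rw [hjb, h k, sub_self]
  rw [infoMatrix, Matrix.smul_mulVec, ← Matrix.mulVec_mulVec, hcol, Matrix.mulVec_zero, smul_zero]

/-- The decision maker with largest outcome `2`, linear utility and scale `1 / cbar`. -/
def linearDecisionMaker (cbar : ℝ) : DecisionMaker cbar where
  b := 2
  b_pos := two_pos
  L := 1
  u := fun x => x / 2
  u_mem := linear_mem_vnmUtilities
  σ := 1 / cbar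
  le_σ := le_rfl

lemma zero_mem_Icc_linear (cbar : ℝ) : (0 : ℝ) ∈ Set.Icc 0 (linearDecisionMaker cbar).b :=
  ⟨le_rfl, zero_le_two⟩

lemma one_mem_Icc_linear (cbar : ℝ) : (1 : ℝ) ∈ Set.Icc 0 (linearDecisionMaker cbar).b :=
  ⟨zero_le_one, one_le_two⟩

/-- The query between the sure outcomes `1` and `0`, repeated `K` times. -/
abbrev repeatedSureQuery (cbar : ℝ) (K : ℕ) : Queries (linearDecisionMaker cbar).b K :=
  Queries.repeated (sureLottery 1 (one_mem_Icc_linear cbar))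
    (sureLottery 0 (zero_mem_Icc_linear cbar)) K

lemma utilityGap_repeatedSureQuery (cbar : ℝ) {K : ℕ} {u : ℝ → ℝ} (hu : u 0 = 0) (k : Fin K) :
    (repeatedSureQuery cbar K).utilityGap u k = u 1 := by
  change (sureLottery 1 (one_mem_Icc_linear cbar)).expect u
    - (sureLottery 0 (zero_mem_Icc_linear cbar)).expect u = u 1
  rw [expect_sureLottery, expect_sureLottery, hu, sub_zero]

lemma logLik_repeatedSureQuery (cbar : ℝ) {K : ℕ} (z : Fin K → ℝ) {u : ℝ → ℝ} (hu : u 0 = 0)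
    (σ : ℝ≥0∞) : (repeatedSureQuery cbar K).logLik z u σ
      = ∑ k, Real.log (1 / (1 + Real.exp (-(z k) * (u 1 * (σ⁻¹).toReal)))) :=
  Finset.sum_congr rfl fun k _ => by rw [utilityGap_repeatedSureQuery cbar hu, mul_assoc]

/-- The errors at the outcomes `1` and `2` differ by `cbar / 2` whatever the scale, so one of them
is at least `cbar / 4` in absolute value. -/
lemma le_errorSup_repeatedSureQuery (cbar : ℝ) {K : ℕ} (hK : 0 < K) {σ : ℝ≥0∞} :
    cbar / 4 ≤ (linearDecisionMaker cbar).errorSup (repeatedSureQuery cbar K)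
      (fun x => min x 1) σ := by
  obtain ⟨i, hi⟩ : ∃ j, (repeatedSureQuery cbar K).y j = 1 := by
    refine Queries.exists_y_eq _ (Queries.support_W_subset _ ⟨0, hK⟩ ?_)
    change (1 : ℝ) ∈ (sureLottery 1 (one_mem_Icc_linear cbar)).finite.toFinset
    rw [toFinset_sureLottery]
    exact Finset.mem_singleton_self _
  obtain ⟨j, hj⟩ : ∃ j, (repeatedSureQuery cbar K).y j = 2 :=
    Queries.exists_y_eq _ (Queries.mem_supportSet_right _)
  have hni := norm_le_pi_norm ((linearDecisionMaker cbar).error (repeatedSureQuery cbar K)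
    (fun x => min x 1) σ) i
  have hnj := norm_le_pi_norm ((linearDecisionMaker cbar).error (repeatedSureQuery cbar K)
    (fun x => min x 1) σ) j
  have hei : (linearDecisionMaker cbar).error (repeatedSureQuery cbar K)
      (fun x => min x 1) σ i = (σ⁻¹).toReal - cbar / 2 := by
    rw [DecisionMaker.error, hi]
    change min 1 1 * (σ⁻¹).toReal - 1 / 2 / (1 / cbar) = _
    rw [min_self, div_div_eq_mul_div]
    ring
  have hej : (linearDecisionMaker cbar).error (repeatedSureQuery cbar K)
      (fun x => min x 1) σ j = (σ⁻¹).toReal - cbar := by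
    rw [DecisionMaker.error, hj]
    change min 2 1 * (σ⁻¹).toReal - 2 / 2 / (1 / cbar) = _
    rw [min_eq_right one_le_two, div_div_eq_mul_div]
    ring
  rw [hei, Real.norm_eq_abs] at hni
  rw [hej, Real.norm_eq_abs] at hnj
  rw [DecisionMaker.errorSup]
  linarith [le_abs_self ((σ⁻¹).toReal - cbar / 2), neg_le_abs ((σ⁻¹).toReal - cbar)]

/-- The likelihood depends only on `v = u 1 / σ ∈ [0, cbar]`, and `min x 1`, with value `1` at `1`,
attains every such `v`. -/
lemma exists_isMLE_repeatedSureQuery {cbar : ℝ} (hc : 0 < cbar) {K : ℕ} (z : Fin K → ℝ) :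
    ∃ σ : ℝ≥0∞, (repeatedSureQuery cbar K).IsMLE (linearDecisionMaker cbar).L cbar z
      (fun x => min x 1) σ := by
  have hcont : Continuous fun v : ℝ =>
      ∑ k, Real.log (1 / (1 + Real.exp (-(z k) * v))) := by
    refine continuous_finsetSum _ fun k _ => Continuous.log ?_ fun v => by positivity
    exact continuous_const.div (by fun_prop) fun v => by positivity
  obtain ⟨v, hv, hmax⟩ := isCompact_Icc.exists_isMaxOn (Set.nonempty_Icc.2 hc.le) hcont.continuousOn
  have hσ : (((ENNReal.ofReal v)⁻¹)⁻¹).toReal = v := by rw [inv_inv, ENNReal.toReal_ofReal hv.1]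
  -- A maximiser `v = 0` corresponds to the scale `∞`.
  refine ⟨(ENNReal.ofReal v)⁻¹, min_one_mem_vnmUtilities, ?_, ?_⟩
  · rw [one_div, ENNReal.ofReal_inv_of_pos hc]
    exact ENNReal.inv_le_inv.2 (ENNReal.ofReal_le_ofReal hv.2)
  · intro u hu σ hσ'
    rw [logLik_repeatedSureQuery cbar z hu.2.2.2.1, logLik_repeatedSureQuery cbar z (by norm_num),
      hσ, min_self, one_mul]
    have h1 := mem_Icc_of_mem_vnmUtilities (linearDecisionMaker cbar).b_pos hu
      (one_mem_Icc_linear cbar)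
    have h2 := toReal_inv_mem_Icc hc hσ'
    exact hmax (a := u 1 * (σ⁻¹).toReal) ⟨mul_nonneg h1.1 h2.1,
      (mul_le_of_le_one_left h2.1 h1.2).trans h2.2⟩

end

theorem mainTheorem5 :
    -- (a), the finite-sample bound
    (∀ cbar : ℝ, 0 < cbar → ∀ (M : DecisionMaker cbar) (K : ℕ) (D : Queries M.b K) (lam : ℝ),
      0 < K → 0 < lam → lambdaMin D.infoMatrix = lam →
      ∀ (Ω : Type v) [MeasurableSpace Ω] (μ : Measure Ω) [IsProbabilityMeasure μ]
        (Z : Fin K → Ω → ℝ), M.IsChoice D μ Z →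
      ∀ δ : ℝ, 0 < δ → δ < 1 →
        ENNReal.ofReal (1 - δ) ≤ μ (M.errorEvent D Z (boundFull cbar lam δ D.N K))) ∧
    -- (a), the order of the bound
    (∀ cbar : ℝ, 0 < cbar → ∀ lam : ℝ, 0 < lam → ∀ δ : ℝ, 0 < δ → δ < 1 →
      ∃ C : ℝ, 0 < C ∧ ∀ N K : ℕ, 2 ≤ N → 0 < K →
        boundFull cbar lam δ N K ≤ C * √((N : ℝ) / K)) ∧
    -- (a.1), fixed number of breakpoints
    (∀ cbar : ℝ, 0 < cbar → ∀ lam : ℝ, 0 < lam → ∀ δ : ℝ, 0 < δ → δ < 1 → ∀ N : ℕ,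
      ∃ C : ℝ, 0 < C ∧
        ∀ (M : DecisionMaker cbar) (K : ℕ) (D : Queries M.b K),
          0 < K → D.N = N → lam ≤ lambdaMin D.infoMatrix →
        ∀ (Ω : Type v) [MeasurableSpace Ω] (μ : Measure Ω) [IsProbabilityMeasure μ]
          (Z : Fin K → Ω → ℝ), M.IsChoice D μ Z →
          ENNReal.ofReal (1 - δ) ≤ μ (M.errorEvent D Z (C / √(K : ℝ)))) ∧
    -- (a.2), consistency (convergence in probability) when `N = o(K)`
    (∀ cbar : ℝ, 0 < cbar → ∀ lam : ℝ, 0 < lam →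
      ∀ (M : DecisionMaker cbar) (K : ℕ → ℕ) (D : ∀ m, Queries M.b (K m)),
        Tendsto K atTop atTop →
        (∀ᶠ m in atTop, lam ≤ lambdaMin (D m).infoMatrix) →
        ((fun m => ((D m).N : ℝ)) =o[atTop] fun m => (K m : ℝ)) →
      ∀ (Ω : ℕ → Type v) [∀ m, MeasurableSpace (Ω m)] (μ : ∀ m, Measure (Ω m))
        [∀ m, IsProbabilityMeasure (μ m)] (Z : ∀ m, Fin (K m) → Ω m → ℝ),
        (∀ m, M.IsChoice (D m) (μ m) (Z m)) →
        ∀ η : ℝ, 0 < η →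
          Tendsto (fun m => μ m (M.errorEvent (D m) (Z m) η)) atTop (𝓝 1)) ∧
    -- (b), the finite-sample bound
    (∀ cbar : ℝ, 0 < cbar → ∀ (M : DecisionMaker cbar) (K : ℕ) (D : Queries M.b K),
      0 < K → lambdaMin D.infoMatrix = 0 →
      ∀ (Ω : Type v) [MeasurableSpace Ω] (μ : Measure Ω) [IsProbabilityMeasure μ]
        (Z : Fin K → Ω → ℝ), M.IsChoice D μ Z →
      ∀ lam : ℝ, 0 < lam → ∀ δ : ℝ, 0 < δ → δ < 1 →
        ENNReal.ofReal (1 - δ) ≤ μ (M.errorEvent D Z (boundDeficient cbar lam δ D.N K))) ∧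
    -- (b), the order of the bound
    (∃ C₂ : ℝ, 0 < C₂ ∧ ∀ cbar : ℝ, 0 < cbar → ∀ lam : ℝ, 0 < lam → ∀ δ : ℝ, 0 < δ → δ < 1 →
      ∃ C₁ : ℝ, 0 < C₁ ∧ ∀ N K : ℕ, 2 ≤ N → 0 < K →
        boundDeficient cbar lam δ N K ≤ C₁ * √((N : ℝ) / K) + C₂ * (cbar * √(N : ℝ))) ∧
    -- (b), the error may fail to converge to zero when a query is repeated
    (∀ cbar : ℝ, 0 < cbar →
      ∃ (M : DecisionMaker cbar) (W Y : Lottery M.b), W ≠ Y ∧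
      ∃ η : ℝ, 0 < η ∧ ∃ ρ : ℝ, 0 < ρ ∧ ∀ K : ℕ, 0 < K →
        lambdaMin (Queries.repeated W Y K).infoMatrix = 0 ∧
        ∀ (Ω : Type v) [MeasurableSpace Ω] (μ : Measure Ω) [IsProbabilityMeasure μ]
          (Z : Fin K → Ω → ℝ), M.IsChoice (Queries.repeated W Y K) μ Z →
          ENNReal.ofReal ρ ≤ μ {ω | ∃ (u : ℝ → ℝ) (σ : ℝ≥0∞),
            (Queries.repeated W Y K).IsMLE M.L cbar (fun k => Z k ω) u σ ∧
            η ≤ M.errorSup (Queries.repeated W Y K) u σ}) := by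
  refine ⟨?_, ?_, ?_, ?_, ?_, ?_, ?_⟩
  · intro cbar hc M K D lam hK hlam hmin Ω _ μ _ Z hZ δ h0 h1
    exact hZ.measure_errorEvent_ge hc hK hlam hmin.ge h0
  · intro cbar _ lam hlam δ h0 h1
    exact exists_boundFull_le cbar hlam h0 h1
  · intro cbar hc lam hlam δ h0 h1 N
    obtain ⟨C, hC, hb⟩ := exists_boundFull_le cbar hlam h0 h1
    -- Adding one keeps the constant positive even for `N = 0`.
    refine ⟨C * √((N : ℝ) + 1), by positivity, fun M K D hK hN hmin Ω _ μ _ Z hZ => ?_⟩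
    refine (hZ.measure_errorEvent_ge hc hK hlam hmin h0).trans
      (measure_mono (M.errorEvent_mono D Z ?_))
    refine (hb D.N K (D.two_le_N M.b_pos) hK).trans ?_
    rw [hN, Real.sqrt_div (Nat.cast_nonneg _), mul_div_assoc]
    gcongr
    linarith
  · intro cbar hc lam hlam M K D hK hmin hN Ω _ μ _ Z hZ η hη
    exact M.tendsto_measure_errorEvent hc hlam hK hmin hN hZ hη
  · intro cbar hc M K D hK _ Ω _ μ _ Z hZ lam hlam δ h0 h1
    have huniv : M.errorEvent D Z (boundDeficient cbar lam δ D.N K) = Set.univ := by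
      refine Set.eq_univ_of_forall fun ω u σ hmle => ⟨M.errorSup_le_errorTwo D u σ, ?_⟩
      exact (M.errorTwo_le D hc hmle.1 hmle.2.1).trans
        (le_boundDeficient hc hlam h0 h1 (one_le_two.trans (D.two_le_N M.b_pos)) K)
    rw [huniv, measure_univ, ← ENNReal.ofReal_one]
    exact ENNReal.ofReal_le_ofReal (by linarith)
  · refine ⟨2, two_pos, fun cbar hc lam hlam δ h0 h1 => ?_⟩
    obtain ⟨C, hC, hb⟩ := exists_boundFull_le cbar hlam h0 h1
    refine ⟨C, hC, fun N K hN hK => ?_⟩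
    linarith [boundDeficient_le hc hlam h0 h1 (one_le_two.trans hN) K, hb N K hN hK]
  · intro cbar hc
    refine ⟨linearDecisionMaker cbar, sureLottery 1 (one_mem_Icc_linear cbar),
      sureLottery 0 (zero_mem_Icc_linear cbar), fun h => ?_, cbar / 4, by positivity, 1, one_pos,
      fun K hK => ⟨?_, fun Ω _ μ _ Z _ => ?_⟩⟩
    · have := congrArg (fun X => X.expect id) h
      rw [expect_sureLottery, expect_sureLottery] at this
      exact one_ne_zero this
    · refine (repeatedSureQuery cbar K).lambdaMin_infoMatrix_eq_zero
        (linearDecisionMaker cbar).b_pos fun k => ?_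
      change (sureLottery 1 (one_mem_Icc_linear cbar)).prob 2
        = (sureLottery 0 (zero_mem_Icc_linear cbar)).prob 2
      rw [prob_sureLottery, prob_sureLottery]
      norm_num
    · refine le_of_le_of_eq (by rw [ENNReal.ofReal_one, measure_univ])
        (congrArg μ (Set.eq_univ_of_forall fun ω => ?_).symm)
      obtain ⟨σ, hσ⟩ := exists_isMLE_repeatedSureQuery hc fun k => Z k ω
      exact ⟨_, σ, hσ, le_errorSup_repeatedSureQuery cbar hK⟩
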